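/- Let $E$ be a complex Banach space and let $L$ be a finite-dimensional nilpotent complex Lie algebra of bounded linear operators acting on the right of $E$ (so $e[x,y]=(ex)y-(ey)x$ for $x,y\in L$, $e\in E$); put $n=\dim L$. For a linear form $f$ on $L$ with $f([L,L])=0$ let $d_p(f)\colon E\otimes\wedge^pL\to E\otimes\wedge^{p-1}L$ be $$d_p(f)\,e\langle x_1\wedge\dots\wedge x_p\rangle=\sum_{k=1}^{p}(-1)^{k+1}e(x_k-f(x_k))\langle x_1\wedge\dots\wedge\hat{x}_k\wedge\dots\wedge x_p\rangle+\sum_{1\le k<l\le p}(-1)^{k+l}e\langle[x_k,x_l]\wedge x_1\wedge\dots\wedge\hat{x}_k\wedge\dots\wedge\hat{x}_l\wedge\dots\wedge x_p\rangle$$ for $1\le p\le n$, and $d_p(f)=0$ for $p\le 0$ or $p\ge n+1$. Let $R(\cdot)$ denote the range. Put $$\Sigma_p(L,E)=\{f\in L^*: f([L,L])=0,\ R(d_{p+1}(f))\ne\ker d_p(f)\},$$ and, for $0\le k\le n$, $$\sigma_{\delta,k}(L,E)=\bigcup_{0\le p\le k}\Sigma_p(L,E),$$ $$\sigma_{\pi,k}(L,E)=\bigcup_{k\le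 p\le n}\Sigma_p(L,E)\ \cup\ \{f\in L^*: f([L,L])=0,\ R(d_k(f))\text{ is not closed}\}.$$ Let $L'$ be the vector space $L$ with the opposite bracket $[x,y]'=[y,x]$, acting on the right of the dual Banach space $E^*$ by the adjoint operators $x^*$, $x\in L$; linear forms on $L'$ are the linear forms on $L$. Then, for every $0\le k\le n$, (i) $\sigma_{\delta,k}(L,E)=\sigma_{\pi,n-k}(L',E^*)$; (ii) $\sigma_{\pi,k}(L,E)=\sigma_{\delta,n-k}(L',E^*)$. -/

import Mathlib

open scoped TensorProduct Topology

attribute [local instance 100] LieRing.ofAssociativeRing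

noncomputable section

namespace SolvableLieSpectra

/-! ### Lie algebras acting on the right of a Banach space

`(E →L[ℂ] E)ᵐᵒᵖ` is the algebra of bounded operators written on the right: the product of `x` and
`y` is the operator `e ↦ (e x) y`. Its Lie bracket is the commutator, so a homomorphism of Lie
algebras `ρ : L → (E →L[ℂ] E)ᵐᵒᵖ` is a right action `e x = (ρ x).unop e` with
`e [x, y] = (e x) y - (e y) x`. -/

section Complex

variable {E L : Type*} [NormedAddCommGroup E] [NormedSpace ℂ E] [LieRing L] [LieAlgebra ℂ L]

/-- The operator `e ↦ e (x - f x)` on `E`. -/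
def shifted (ρ : L →ₗ⁅ℂ⁆ (E →L[ℂ] E)ᵐᵒᵖ) (f : Module.Dual ℂ L) (x : L) : E →ₗ[ℂ] E :=
  ((ρ x).unop : E →ₗ[ℂ] E) - f x • LinearMap.id

/-- `x ↦ (x₁, …, x_p) ↦ (e ↦ e (x - f x) ⊗ x₁ ∧ … ∧ x_p)`. -/
def actionForm (ρ : L →ₗ⁅ℂ⁆ (E →L[ℂ] E)ᵐᵒᵖ) (f : Module.Dual ℂ L) (p : ℕ) :
    L →ₗ[ℂ] L [⋀^Fin p]→ₗ[ℂ] (E →ₗ[ℂ] E ⊗[ℂ] ⋀[ℂ]^p L) where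
  toFun x := (LinearMap.lcomp ℂ (E ⊗[ℂ] ⋀[ℂ]^p L) (shifted ρ f x) ∘ₗ
    (TensorProduct.mk ℂ E (⋀[ℂ]^p L)).flip).compAlternatingMap (exteriorPower.ιMulti ℂ p)
  map_add' x y := by
    ext v e
    simp only [shifted, LinearMap.compAlternatingMap_apply, LinearMap.comp_apply,
      LinearMap.lcomp_apply, AlternatingMap.add_apply, LinearMap.add_apply, ← map_add]
    congr 1
    simp [add_smul]
    abel
  map_smul' c x := by
    ext v e
    simp [shifted, TensorProduct.smul_tmul', smul_sub, mul_smul]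

/-- `x ↦ y ↦ (x₁, …, x_p) ↦ [x, y] ∧ x₁ ∧ … ∧ x_p`. -/
def bracketForm (L : Type*) [LieRing L] [LieAlgebra ℂ L] (p : ℕ) :
    L →ₗ[ℂ] L →ₗ[ℂ] L [⋀^Fin p]→ₗ[ℂ] ⋀[ℂ]^(p + 1) L :=
  ((LieAlgebra.ad ℂ L : L →ₗ⁅ℂ⁆ Module.End ℂ L) : L →ₗ[ℂ] Module.End ℂ L).compr₂
    (exteriorPower.ιMulti ℂ (p + 1) (M := L)).curryLeft

/-- The map `⋀^(p+1) L → ⋀^p L` given by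
`x₁ ∧ … ∧ x_(p+1) ↦ ∑_{k<l} (-1)^(k+l) [x_k, x_l] ∧ x₁ ∧ … x̂_k … x̂_l … ∧ x_(p+1)`.
Mathlib's `alternatizeUncurryFin`, applied twice, sums over ordered pairs, hence the factor `1/2`;
see `boundary_tmul_two` for the explicit formula. -/
def bracketPart (L : Type*) [LieRing L] [LieAlgebra ℂ L] :
    (p : ℕ) → ⋀[ℂ]^(p + 1) L →ₗ[ℂ] ⋀[ℂ]^p L
  | 0 => 0
  | p + 1 => (-(1 / 2) : ℂ) • exteriorPower.alternatingMapLinearEquiv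
      (AlternatingMap.alternatizeUncurryFin
        (AlternatingMap.alternatizeUncurryFinLM ∘ₗ bracketForm L p))

/-- The boundary map `E ⊗ ⋀^(p+1) L → E ⊗ ⋀^p L`:
`e ⟨x₁ ∧ … ∧ x_(p+1)⟩ ↦ ∑_k (-1)^(k+1) e (x_k - f x_k) ⟨x₁ ∧ … x̂_k … ∧ x_(p+1)⟩`
`  + ∑_{k<l} (-1)^(k+l) e ⟨[x_k, x_l] ∧ x₁ ∧ … x̂_k … x̂_l … ∧ x_(p+1)⟩`. -/
def boundary (ρ : L →ₗ⁅ℂ⁆ (E →L[ℂ] E)ᵐᵒᵖ) (f : Module.Dual ℂ L) (p : ℕ) :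
    E ⊗[ℂ] ⋀[ℂ]^(p + 1) L →ₗ[ℂ] E ⊗[ℂ] ⋀[ℂ]^p L :=
  TensorProduct.lift (exteriorPower.alternatingMapLinearEquiv
    (AlternatingMap.alternatizeUncurryFin (actionForm ρ f p))).flip +
  (bracketPart L p).lTensor E

/-- The explicit formula for `d₁`: `e ⟨x⟩ ↦ e (x - f x)`. -/
theorem boundary_tmul_one (ρ : L →ₗ⁅ℂ⁆ (E →L[ℂ] E)ᵐᵒᵖ) (f : Module.Dual ℂ L)
    (e : E) (v : Fin 1 → L) :
    boundary ρ f 0 (e ⊗ₜ exteriorPower.ιMulti ℂ 1 v) =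
      ((ρ (v 0)).unop e - f (v 0) • e) ⊗ₜ exteriorPower.ιMulti ℂ 0 (Fin.removeNth 0 v) := by
  simp [boundary, bracketPart, actionForm, shifted, AlternatingMap.alternatizeUncurryFin_apply,
    TensorProduct.sub_tmul, TensorProduct.smul_tmul']

/-- The explicit formula for `d_(p+2)`, with indices counted from `0`: the pair `k < l` of the
classical formula is encoded as `k = i` and `l = j + 1` with `i ≤ j`, and the signs read
`(-1)^k` and `(-1)^(k+l)`. -/
theorem boundary_tmul_two (ρ : L →ₗ⁅ℂ⁆ (E →L[ℂ] E)ᵐᵒᵖ) (f : Module.Dual ℂ L) (p : ℕ)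
    (e : E) (v : Fin (p + 2) → L) :
    boundary ρ f (p + 1) (e ⊗ₜ exteriorPower.ιMulti ℂ (p + 2) v) =
      ∑ k : Fin (p + 2), (-1 : ℤ) ^ (k : ℕ) •
        (((ρ (v k)).unop e - f (v k) • e) ⊗ₜ[ℂ] exteriorPower.ιMulti ℂ (p + 1) (k.removeNth v)) +
      ∑ i : Fin (p + 1), ∑ j ≥ i, (-1 : ℤ) ^ ((i : ℕ) + (j + 1 : ℕ)) •
        (e ⊗ₜ[ℂ] exteriorPower.ιMulti ℂ (p + 1)
          (Matrix.vecCons ⁅v i.castSucc, v j.succ⁆ (j.removeNth (i.castSucc.removeNth v)))) := by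
  have h2 : ∀ (x y : L) (w : Fin p → L), bracketForm L p x y w =
      exteriorPower.ιMulti ℂ (p + 1) (Matrix.vecCons ⁅x, y⁆ w) := fun x y w => rfl
  have h3 : ∀ (x y : L) (w : Fin p → L), bracketForm L p x y w - bracketForm L p y x w =
      (2 : ℂ) • bracketForm L p x y w := by
    intro x y w
    have : bracketForm L p y x w = - bracketForm L p x y w := by
      have hs : (exteriorPower.ιMulti ℂ (p + 1) (M := L)).curryLeft ⁅y, x⁆ =
          -(exteriorPower.ιMulti ℂ (p + 1) (M := L)).curryLeft ⁅x, y⁆ := by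
        rw [← lie_skew, map_neg]
      exact congrArg (fun g => g w) hs
    rw [this, two_smul, sub_neg_eq_add]
  simp only [boundary, LinearMap.add_apply, TensorProduct.lift.tmul, LinearMap.flip_apply,
    LinearMap.lTensor_tmul, bracketPart, LinearMap.smul_apply,
    exteriorPower.alternatingMapLinearEquiv_apply_ιMulti,
    AlternatingMap.alternatizeUncurryFin_alternatizeUncurryFinLM_comp_apply, h3]
  congr 1
  · simp [AlternatingMap.alternatizeUncurryFin_apply, actionForm, shifted,
      TensorProduct.sub_tmul, TensorProduct.smul_tmul']
  · simp only [Finset.smul_sum, TensorProduct.tmul_sum, h2]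
    refine Finset.sum_congr rfl fun i _ => Finset.sum_congr rfl fun j _ => ?_
    rw [smul_comm (-(1 / 2) : ℂ), smul_smul, ← add_assoc, pow_succ]
    norm_num [TensorProduct.tmul_neg, TensorProduct.tmul_smul]

/-- The differential `d_p(f) : E ⊗ ⋀^p L → E ⊗ ⋀^(p-1) L`, with `d_0(f) = 0`. -/
def differential (ρ : L →ₗ⁅ℂ⁆ (E →L[ℂ] E)ᵐᵒᵖ) (f : Module.Dual ℂ L) :
    (p : ℕ) → E ⊗[ℂ] ⋀[ℂ]^p L →ₗ[ℂ] E ⊗[ℂ] ⋀[ℂ]^(p - 1) L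
  | 0 => 0
  | p + 1 => boundary ρ f p

end Complex

/-- The topology of `E ⊗ V` for a finite-dimensional space `V`: the coarsest one for which all maps
`id ⊗ φ : E ⊗ V → E`, `φ` a linear form on `V`, are continuous. A basis of `V` with `d` elements
identifies it with the product topology of `E^d`, i.e. with the Banach space topology. -/
@[reducible] def tensorTopology (E V : Type*) [NormedAddCommGroup E] [NormedSpace ℂ E]
    [AddCommGroup V] [Module ℂ V] : TopologicalSpace (E ⊗[ℂ] V) :=
  ⨅ φ : Module.Dual ℂ V, TopologicalSpace.induced
    (fun t => TensorProduct.rid ℂ E (φ.lTensor E t)) inferInstance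

section Spectra

variable {E L : Type*} [NormedAddCommGroup E] [NormedSpace ℂ E] [LieRing L] [LieAlgebra ℂ L]

/-- The annihilator of `L² = [L, L]` in the dual space of `L`: the characters of `L`. -/
def characters (L : Type*) [LieRing L] [LieAlgebra ℂ L] : Set (Module.Dual ℂ L) :=
  {f | ∀ x y : L, f ⁅x, y⁆ = 0}

/-- `Σ_p(L, E)`: the characters `f` with `R(d_{p+1}(f)) ≠ ker d_p(f)`, that is, with nonzero
`p`-th homology. -/
def Sig (ρ : L →ₗ⁅ℂ⁆ (E →L[ℂ] E)ᵐᵒᵖ) (p : ℕ) : Set (Module.Dual ℂ L) :=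
  {f | f ∈ characters L ∧
    LinearMap.range (differential ρ f (p + 1)) ≠ LinearMap.ker (differential ρ f p)}

/-- `σ_{δ,k}(L, E)`, the union of the `Σ_p(L, E)` for `0 ≤ p ≤ k`. -/
def sigmaDelta (ρ : L →ₗ⁅ℂ⁆ (E →L[ℂ] E)ᵐᵒᵖ) (k : ℕ) : Set (Module.Dual ℂ L) :=
  ⋃ p ∈ Set.Icc 0 k, Sig ρ p

/-- `σ_{π,k}(L, E)`, the union of the `Σ_p(L, E)` for `k ≤ p ≤ n = dim L` and of the set of the
characters `f` for which the range of `d_k(f)` is not closed. -/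
def sigmaPi (ρ : L →ₗ⁅ℂ⁆ (E →L[ℂ] E)ᵐᵒᵖ) (k : ℕ) : Set (Module.Dual ℂ L) :=
  (⋃ p ∈ Set.Icc k (Module.finrank ℂ L), Sig ρ p) ∪
    {f | f ∈ characters L ∧ ¬ IsClosed[tensorTopology E (⋀[ℂ]^(k - 1) L)]
      (LinearMap.range (differential ρ f k) : Set (E ⊗[ℂ] ⋀[ℂ]^(k - 1) L))}

end Spectra

/-! ### The opposite Lie algebra and its action on the dual space -/

/-- `L'`: the vector space `L` with the bracket `[x, y]' = [y, x]`. -/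
structure OppositeLie (L : Type*) where
  /-- the element of `L'` given by an element of `L` -/
  of ::
  /-- the underlying element of `L` -/
  val : L

section Opposite

variable {E L : Type*} [NormedAddCommGroup E] [NormedSpace ℂ E] [LieRing L] [LieAlgebra ℂ L]

/-- The identity of the underlying set, from `L'` to `L`. -/
def oppositeEquiv (L : Type*) : OppositeLie L ≃ L where
  toFun := OppositeLie.val
  invFun := OppositeLie.of
  left_inv _ := rfl
  right_inv _ := rfl

instance : AddCommGroup (OppositeLie L) := (oppositeEquiv L).addCommGroup

instance : Module ℂ (OppositeLie L) := (oppositeEquiv L).module ℂ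

/-- The identity of the underlying vector space, from `L'` to `L`. -/
def ofOpposite (L : Type*) [LieRing L] [LieAlgebra ℂ L] : OppositeLie L ≃ₗ[ℂ] L :=
  (oppositeEquiv L).linearEquiv ℂ

instance : Bracket (OppositeLie L) (OppositeLie L) :=
  ⟨fun x y => (ofOpposite L).symm ⁅ofOpposite L y, ofOpposite L x⁆⟩

theorem ofOpposite_lie (x y : OppositeLie L) :
    ofOpposite L ⁅x, y⁆ = ⁅ofOpposite L y, ofOpposite L x⁆ := rfl

instance : LieRing (OppositeLie L) where
  add_lie x y z := (ofOpposite L).injective (by simp [ofOpposite_lie])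
  lie_add x y z := (ofOpposite L).injective (by simp [ofOpposite_lie])
  lie_self x := (ofOpposite L).injective (by simp [ofOpposite_lie])
  leibniz_lie x y z := (ofOpposite L).injective (by
    simp only [ofOpposite_lie, map_add]
    generalize ofOpposite L x = a
    generalize ofOpposite L y = b
    generalize ofOpposite L z = c
    rw [leibniz_lie c b a, add_comm, ← lie_skew c a, lie_neg, ← lie_skew b, ← lie_skew ⁅a, c⁆ b]
    simp
    abel)

instance : LieAlgebra ℂ (OppositeLie L) where
  lie_smul c x y := (ofOpposite L).injective (by simp [ofOpposite_lie])

/-- The adjoint operator `x^*` of `x` on the space `E^*` of continuous linear functionals. -/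
def adjointOp (x : E →L[ℂ] E) : StrongDual ℂ E →L[ℂ] StrongDual ℂ E :=
  (ContinuousLinearMap.compL ℂ E E ℂ).flip x

theorem adjointOp_apply (x : E →L[ℂ] E) (φ : StrongDual ℂ E) (e : E) :
    adjointOp x φ e = φ (x e) := rfl

/-- The right action of `L'` on `E^*` by the adjoint operators. -/
def dualAction (ρ : L →ₗ⁅ℂ⁆ (E →L[ℂ] E)ᵐᵒᵖ) :
    OppositeLie L →ₗ⁅ℂ⁆ (StrongDual ℂ E →L[ℂ] StrongDual ℂ E)ᵐᵒᵖ where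
  toFun x := MulOpposite.op (adjointOp (ρ (ofOpposite L x)).unop)
  map_add' x y := MulOpposite.unop_injective (by ext; simp [adjointOp_apply])
  map_smul' c x := MulOpposite.unop_injective (by ext; simp [adjointOp_apply])
  map_lie' {x y} := MulOpposite.unop_injective (by
    ext; simp [adjointOp_apply, ofOpposite_lie, Ring.lie_def])

/-- A set of linear forms on `L'`, regarded as a set of linear forms on `L`, which is the same
vector space. -/
def toDualOf (S : Set (Module.Dual ℂ (OppositeLie L))) : Set (Module.Dual ℂ L) :=
  {f | f ∘ₗ (ofOpposite L : OppositeLie L →ₗ[ℂ] L) ∈ S}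

end Opposite

end SolvableLieSpectra

end

/-! Let n = dim L. For p + q = n the exterior product ⋀^p L × ⋀^q L → ⋀^n L ≅ ℂ is a perfect
pairing, so E* ⊗ ⋀^q L' is, with its topology, the dual of E ⊗ ⋀^p L. The point is that under this
identification d_q of L' on E* is ± the adjoint of d_(p+1) of L on E (`dualEquiv_boundary`).

To see this, write the differential in a basis (b_i) with contractions: the action term is ∑ (b_i -
f(b_i)) ⊗ (b_i* ⌟ ·), the bracket term is -1/2 ∑ [b_i, b_j] ∧ (b_j* ⌟ (b_i* ⌟ ·)). Contractions are
antiderivations and products of degree n + 1 vanish, so contractions pass from one factor to the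
other up to sign. The bracket term passes over as well (`bracketOp_mul`), except for terms in tr(ad
x), which vanish because L is nilpotent. The relative sign between the two terms is absorbed by the
opposite bracket.

The rest is functional analysis. By the closed range theorem d_(p+1) and its adjoint have closed
range together. Exactness at p with R(d_p) closed gives exactness of the dual complex
(`ExactAt.dual`); dual exactness with R(d_(p+1)) closed gives it back (`ExactAt.of_dual`). Exactness
makes a range a kernel, hence closed, so closedness is in question only at the edge of the range of
degrees. That is what the extra set in σ_π controls. -/

noncomputable section

namespace SolvableLieSpectra

/-! ### The closed range theorem -/

section ClosedRange

variable {X Y : Type*} [NormedAddCommGroup X] [NormedSpace ℂ X]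
  [NormedAddCommGroup Y] [NormedSpace ℂ Y]

/-- The Banach space adjoint `ψ ↦ ψ ∘ T` of a bounded operator. -/
def dualOp (T : X →L[ℂ] Y) : StrongDual ℂ Y →L[ℂ] StrongDual ℂ X :=
  (ContinuousLinearMap.compL ℂ X Y ℂ).flip T

@[simp]
theorem dualOp_apply (T : X →L[ℂ] Y) (ψ : StrongDual ℂ Y) (x : X) : dualOp T ψ x = ψ (T x) := rfl

/-- A functional vanishing on ker T factors through T. The closed range is a Banach space, so T is a
quotient map onto it by the open mapping theorem and the factor is continuous; Hahn-Banach extends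
it to Y. -/
theorem mem_range_dualOp [CompleteSpace X] [CompleteSpace Y] (T : X →L[ℂ] Y)
    (hT : IsClosed (LinearMap.range (T : X →ₗ[ℂ] Y) : Set Y)) (ψ : StrongDual ℂ X)
    (hψ : ∀ x, T x = 0 → ψ x = 0) : ∃ φ, dualOp T φ = ψ := by
  let R := LinearMap.range (T : X →ₗ[ℂ] Y)
  have : CompleteSpace R := hT.completeSpace_coe
  let T' : X →L[ℂ] R := T.codRestrict R fun x => ⟨x, rfl⟩
  have hs : Function.Surjective T' := by
    rintro ⟨_, x, rfl⟩
    exact ⟨x, rfl⟩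
  have hmem : (ψ : X →ₗ[ℂ] ℂ) ∈ LinearMap.range (T' : X →ₗ[ℂ] R).dualMap := by
    rw [LinearMap.range_dualMap_eq_dualAnnihilator_ker, Submodule.mem_dualAnnihilator]
    intro x hx
    exact hψ x (congrArg Subtype.val (LinearMap.mem_ker.1 hx))
  obtain ⟨g, hg⟩ := hmem
  have hg' : ∀ x, g (T' x) = ψ x := fun x => congrArg (fun h => h x) hg
  have hc : Continuous g := by
    rw [(T'.isQuotientMap hs).continuous_iff]
    have : (g ∘ T') = ψ := funext hg'
    rw [this]
    exact ψ.continuous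
  obtain ⟨φ, hφ, -⟩ := exists_extension_norm_eq R (⟨g, hc⟩ : StrongDual ℂ R)
  refine ⟨φ, ?_⟩
  ext x
  rw [← hg' x]
  exact hφ (T' x)

theorem isClosed_range_dualOp [CompleteSpace X] [CompleteSpace Y] (T : X →L[ℂ] Y)
    (hT : IsClosed (LinearMap.range (T : X →ₗ[ℂ] Y) : Set Y)) :
    IsClosed (Set.range (dualOp T)) := by
  have : Set.range (dualOp T) = ⋂ x ∈ {x | T x = 0}, {ψ : StrongDual ℂ X | ψ x = 0} := by
    ext ψ
    simp only [Set.mem_range, Set.mem_iInter, Set.mem_ofPred_eq]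
    refine ⟨?_, mem_range_dualOp T hT ψ⟩
    rintro ⟨φ, rfl⟩ x hx
    simp [hx]
  rw [this]
  refine isClosed_biInter fun x _ => isClosed_eq ?_ continuous_const
  exact (ContinuousLinearMap.apply ℂ ℂ x).continuous

/-- If the image of the unit ball were not dense in a ball, a functional would separate. -/
theorem mem_closure_image_closedBall (T : X →L[ℂ] Y) {c : ℝ}
    (h : ∀ ψ : StrongDual ℂ Y, c * ‖ψ‖ ≤ ‖dualOp T ψ‖) {y : Y} (hy : ‖y‖ < c) :
    y ∈ closure (T '' Metric.closedBall 0 1) := by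
  by_contra hn
  have hconv : Convex ℝ (closure (T '' Metric.closedBall 0 1)) := by
    refine Convex.closure ?_
    exact (convex_closedBall (0 : X) 1).linear_image ((T : X →ₗ[ℂ] Y).restrictScalars ℝ)
  obtain ⟨f, u, hfu, hu⟩ := RCLike.geometric_hahn_banach_closed_point (𝕜 := ℂ) hconv
    isClosed_closure hn
  have hb : ∀ x ∈ Metric.closedBall (0 : X) 1, ‖f (T x)‖ ≤ u := by
    intro x hx
    -- Rotating x by a phase turns the bound on the real part of f ∘ T into a bound on its modulus.
    obtain ⟨z, hz, hzx⟩ : ∃ z : ℂ, ‖z‖ = 1 ∧ z * f (T x) = ‖f (T x)‖ := by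
      by_cases h0 : f (T x) = 0
      · exact ⟨1, by simp, by simp [h0]⟩
      · refine ⟨‖f (T x)‖ / f (T x), by simp [h0], ?_⟩
        field_simp
    have := hfu (T (z • x)) (subset_closure ⟨z • x, by simpa [norm_smul, hz] using hx, rfl⟩)
    rw [map_smul, map_smul, smul_eq_mul, hzx] at this
    simpa using this.le
  have hu0 : 0 ≤ u := (norm_nonneg _).trans (hb 0 (by simp))
  have hnorm : ‖dualOp T f‖ ≤ u := by
    exact ContinuousLinearMap.opNorm_le_of_unit_norm hu0 fun x hx => hb x (by simp [hx])
  have h1 : u < ‖f‖ * ‖y‖ := hu.trans_le ((Complex.re_le_norm _).trans (f.le_opNorm y))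
  have h2 := h f
  nlinarith [norm_nonneg f]

/-- Successive approximation, as in the open mapping theorem: a controlled x brings T x within half
the norm of y, and the corrections form a convergent series. -/
theorem surjective_of_dualOp_bounded_below [CompleteSpace X] (T : X →L[ℂ] Y) {c : ℝ} (hc : 0 < c)
    (h : ∀ ψ : StrongDual ℂ Y, c * ‖ψ‖ ≤ ‖dualOp T ψ‖) : Function.Surjective T := by
  have key : ∀ y : Y, ∃ x : X, ‖y - T x‖ ≤ 1 / 2 * ‖y‖ ∧ ‖x‖ ≤ 2 / c * ‖y‖ := by
    intro y
    by_cases hy : y = 0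
    · exact ⟨0, by simp [hy]⟩
    have hy' : 0 < ‖y‖ := norm_pos_iff.2 hy
    -- Scaling to norm c/2 puts y strictly inside the ball of radius c; an error below c/4 there is
    -- at most ‖y‖/2 after scaling back.
    let t : ℝ := c / (2 * ‖y‖)
    have ht : 0 < t := by positivity
    have hty : ‖(t : ℂ) • y‖ = c / 2 := by
      rw [norm_smul, Complex.norm_real, Real.norm_of_nonneg ht.le]
      simp only [t]
      field_simp
    obtain ⟨_, ⟨x, hx, rfl⟩, hd⟩ := Metric.mem_closure_iff.1
      (mem_closure_image_closedBall T h (y := (t : ℂ) • y) (by rw [hty]; linarith)) (c / 4) (by positivity)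
    rw [dist_eq_norm] at hd
    have hx : ‖x‖ ≤ 1 := by simpa using hx
    have ht0 : (t : ℂ) ≠ 0 := by exact_mod_cast ht.ne'
    have htinv : ‖((t : ℂ)⁻¹)‖ = 2 * ‖y‖ / c := by
      rw [norm_inv, Complex.norm_real, Real.norm_of_nonneg ht.le]
      simp only [t]
      field_simp
    refine ⟨(t : ℂ)⁻¹ • x, ?_, ?_⟩
    · have : y - T ((t : ℂ)⁻¹ • x) = (t : ℂ)⁻¹ • ((t : ℂ) • y - T x) := by
        rw [smul_sub, smul_smul, inv_mul_cancel₀ ht0, one_smul, map_smul]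
      rw [this, norm_smul, htinv]
      calc 2 * ‖y‖ / c * ‖(t : ℂ) • y - T x‖ ≤ 2 * ‖y‖ / c * (c / 4) := by gcongr
        _ = 1 / 2 * ‖y‖ := by field_simp; norm_num
    · rw [norm_smul, htinv]
      calc 2 * ‖y‖ / c * ‖x‖ ≤ 2 * ‖y‖ / c * 1 := by gcongr
        _ = 2 / c * ‖y‖ := by ring
  choose g hg hgn using key
  intro y
  -- The remainder of y after n corrections.
  let z : ℕ → Y := fun n => (fun w => w - T (g w))^[n] y
  have hz0 : z 0 = y := rfl
  have hz : ∀ n, z (n + 1) = z n - T (g (z n)) := fun n => Function.iterate_succ_apply' _ _ _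
  have hzn : ∀ n, ‖z n‖ ≤ (1 / 2) ^ n * ‖y‖ := by
    intro n
    induction n with
    | zero => simp [hz0]
    | succ n ih =>
      rw [hz]
      refine (hg _).trans ?_
      rw [pow_succ]
      linarith
  have hsum : Summable fun n => g (z n) := by
    refine Summable.of_norm_bounded (g := fun n : ℕ => (1 / 2 : ℝ) ^ n * (2 / c * ‖y‖)) ?_ ?_
    · exact (summable_geometric_of_lt_one (by norm_num) (by norm_num)).mul_right _
    · intro n
      refine (hgn _).trans ?_
      calc 2 / c * ‖z n‖ ≤ 2 / c * ((1 / 2) ^ n * ‖y‖) := by gcongr; exact hzn n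
        _ = _ := by ring
  refine ⟨∑' n, g (z n), ?_⟩
  have hpart : ∀ n, T (∑ i ∈ Finset.range n, g (z i)) = y - z n := by
    intro n
    induction n with
    | zero => simp [hz0]
    | succ n ih => rw [Finset.sum_range_succ, map_add, ih, hz]; abel
  have h1 : Filter.Tendsto (fun n => T (∑ i ∈ Finset.range n, g (z i))) Filter.atTop
      (𝓝 (T (∑' n, g (z n)))) :=
    (T.continuous.tendsto _).comp hsum.hasSum.tendsto_sum_nat
  have hz' : Filter.Tendsto z Filter.atTop (𝓝 0) := by
    refine squeeze_zero_norm hzn ?_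
    simpa using (tendsto_pow_atTop_nhds_zero_of_lt_one (r := (1 / 2 : ℝ)) (by norm_num)
      (by norm_num)).mul_const ‖y‖
  have h2 : Filter.Tendsto (fun n => T (∑ i ∈ Finset.range n, g (z i))) Filter.atTop (𝓝 y) := by
    simp only [hpart]
    simpa using hz'.const_sub y
  exact tendsto_nhds_unique h1 h2

/-- Regard T as a map T' into the closure of its range. By Hahn-Banach the adjoint keeps its range,
and density makes it injective; with closed range it is then bounded below. Hence T' is onto, and
the range of T equals its closure. -/
theorem isClosed_range_of_dualOp [CompleteSpace X] (T : X →L[ℂ] Y)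
    (hT : IsClosed (Set.range (dualOp T))) :
    IsClosed (LinearMap.range (T : X →ₗ[ℂ] Y) : Set Y) := by
  let R := (LinearMap.range (T : X →ₗ[ℂ] Y)).topologicalClosure
  let T' : X →L[ℂ] R := T.codRestrict R fun x =>
    Submodule.le_topologicalClosure _ ⟨x, rfl⟩
  have hrange : Set.range (dualOp T') = Set.range (dualOp T) := by
    ext ψ
    constructor
    · rintro ⟨φ, rfl⟩
      obtain ⟨g, hg, -⟩ := exists_extension_norm_eq R φ
      exact ⟨g, by ext x; exact hg (T' x)⟩
    · rintro ⟨φ, rfl⟩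
      exact ⟨φ.comp R.subtypeL, by ext x; rfl⟩
  have hdense : DenseRange T' := by
    intro y
    rw [closure_subtype]
    have : (Subtype.val '' Set.range T') = (LinearMap.range (T : X →ₗ[ℂ] Y) : Set Y) := by
      ext y
      constructor
      · rintro ⟨_, ⟨x, rfl⟩, rfl⟩
        exact ⟨x, rfl⟩
      · rintro ⟨x, rfl⟩
        exact ⟨_, ⟨x, rfl⟩, rfl⟩
    rw [this]
    exact y.2
  have hinj : Function.Injective (dualOp T') := by
    intro φ ψ h
    have : (φ : R → ℂ) = ψ := hdense.equalizer φ.continuous ψ.continuous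
      (funext fun x => congrArg (fun g => g x) h)
    exact DFunLike.coe_injective this
  obtain ⟨K, hK⟩ := (dualOp T').antilipschitz_of_injective_of_isClosed_range hinj
    (by rw [hrange]; exact hT)
  have hsurj : Function.Surjective T' := by
    -- `K + 1` rather than `K`, since the antilipschitz constant may be zero.
    refine surjective_of_dualOp_bounded_below T' (c := ((K : ℝ) + 1)⁻¹) (by positivity) fun ψ => ?_
    have := hK.le_mul_dist ψ 0
    rw [map_zero, dist_zero_right, dist_zero_right] at this
    rw [inv_mul_le_iff₀ (by positivity)]
    nlinarith [norm_nonneg (dualOp T' ψ)]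
  have : LinearMap.range (T : X →ₗ[ℂ] Y) = R := by
    refine le_antisymm (Submodule.le_topologicalClosure _) fun y hy => ?_
    obtain ⟨x, hx⟩ := hsurj ⟨y, hy⟩
    exact ⟨x, congrArg Subtype.val hx⟩
  rw [this]
  exact Submodule.isClosed_topologicalClosure _

theorem isClosed_range_dualOp_iff [CompleteSpace X] [CompleteSpace Y] (T : X →L[ℂ] Y) :
    IsClosed (Set.range (dualOp T)) ↔ IsClosed (LinearMap.range (T : X →ₗ[ℂ] Y) : Set Y) :=
  ⟨isClosed_range_of_dualOp T, isClosed_range_dualOp T⟩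

/-- Hahn-Banach: a closed subspace is the annihilator of its annihilator. -/
theorem mem_range_of_forall_dual (T : X →L[ℂ] Y)
    (hT : IsClosed (LinearMap.range (T : X →ₗ[ℂ] Y) : Set Y)) (y : Y)
    (hy : ∀ ψ : StrongDual ℂ Y, dualOp T ψ = 0 → ψ y = 0) : ∃ x, T x = y := by
  by_contra hn
  have := hT
  -- The quotient by a closed subspace is a normed space, so its functionals separate the class of y
  -- from 0.
  obtain ⟨f, hf⟩ := SeparatingDual.exists_ne_zero (R := ℂ)
    (x := (LinearMap.range (T : X →ₗ[ℂ] Y)).mkQ y) (by simpa using hn)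
  refine hf (hy (f.comp (LinearMap.range (T : X →ₗ[ℂ] Y)).mkQL) ?_)
  ext x
  have : (LinearMap.range (T : X →ₗ[ℂ] Y)).mkQ (T x) = 0 := by simp
  change f ((LinearMap.range (T : X →ₗ[ℂ] Y)).mkQ (T x)) = 0
  rw [this, map_zero]

end ClosedRange

/-! ### Contractions on the exterior algebra -/

section Contraction

open ExteriorAlgebra CliffordAlgebra

variable {V : Type*} [AddCommGroup V] [Module ℂ V]

/-- The contraction by a linear form, an antiderivation of the exterior algebra. -/
abbrev contract (l : Module.Dual ℂ V) : ExteriorAlgebra ℂ V →ₗ[ℂ] ExteriorAlgebra ℂ V :=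
  CliffordAlgebra.contractLeft (Q := (0 : QuadraticForm ℂ V)) l

/-- The grading involution of the exterior algebra. -/
abbrev gradeInv : ExteriorAlgebra ℂ V →ₐ[ℂ] ExteriorAlgebra ℂ V :=
  CliffordAlgebra.involute (Q := (0 : QuadraticForm ℂ V))

theorem ι_mul_ι_eq_neg (x y : V) : ExteriorAlgebra.ι ℂ x * ExteriorAlgebra.ι ℂ y =
    -(ExteriorAlgebra.ι ℂ y * ExteriorAlgebra.ι ℂ x) :=
  eq_neg_of_add_eq_zero_left (ExteriorAlgebra.ι_add_mul_swap x y)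

theorem contract_ι_mul (l : Module.Dual ℂ V) (x : V) (u : ExteriorAlgebra ℂ V) :
    contract l (ExteriorAlgebra.ι ℂ x * u) = l x • u - ExteriorAlgebra.ι ℂ x * contract l u :=
  CliffordAlgebra.contractLeft_ι_mul _ _ _

theorem contract_mul (l : Module.Dual ℂ V) (u w : ExteriorAlgebra ℂ V) :
    contract l (u * w) = contract l u * w + gradeInv u * contract l w := by
  induction u using CliffordAlgebra.left_induction with
  | algebraMap r => simp [CliffordAlgebra.contractLeft_algebraMap_mul,
      CliffordAlgebra.contractLeft_algebraMap]
  | add x y hx hy => rw [add_mul, map_add, hx, hy, map_add, map_add]; noncomm_ring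
  | ι_mul x m h =>
    change contract l (ExteriorAlgebra.ι ℂ m * x * w) =
      contract l (ExteriorAlgebra.ι ℂ m * x) * w + gradeInv (ExteriorAlgebra.ι ℂ m * x) * _
    have hi : gradeInv (ExteriorAlgebra.ι ℂ m) = -ExteriorAlgebra.ι ℂ m :=
      CliffordAlgebra.involute_ι m
    rw [mul_assoc, contract_ι_mul, h, contract_ι_mul, map_mul, hi, sub_mul, smul_mul_assoc]
    noncomm_ring

theorem ι_mul_eq_gradeInv_mul_ι (x : V) (u : ExteriorAlgebra ℂ V) :
    ExteriorAlgebra.ι ℂ x * u = gradeInv u * ExteriorAlgebra.ι ℂ x := by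
  induction u using CliffordAlgebra.left_induction with
  | algebraMap r => simp [Algebra.commutes]
  | add x y hx hy => rw [mul_add, hx, hy, map_add, add_mul]
  | ι_mul u m h =>
    change ExteriorAlgebra.ι ℂ x * (ExteriorAlgebra.ι ℂ m * u) =
      gradeInv (ExteriorAlgebra.ι ℂ m * u) * _
    have hi : gradeInv (ExteriorAlgebra.ι ℂ m) = -ExteriorAlgebra.ι ℂ m :=
      CliffordAlgebra.involute_ι m
    rw [map_mul, hi, mul_assoc, ← h, ← mul_assoc, ← mul_assoc,
      ι_mul_ι_eq_neg, neg_mul, neg_mul, neg_mul]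

theorem gradeInv_of_mem {p : ℕ} {u : ExteriorAlgebra ℂ V} (hu : u ∈ ⋀[ℂ]^p V) :
    gradeInv u = (-1 : ℂ) ^ p • u := by
  rw [← ExteriorAlgebra.ιMulti_span_fixedDegree] at hu
  induction hu using Submodule.span_induction with
  | zero => simp
  | add x y _ _ hx hy => rw [map_add, hx, hy, smul_add]
  | smul c x _ hx => rw [map_smul, hx, smul_comm]
  | mem x hx =>
    obtain ⟨v, rfl⟩ := hx
    induction p with
    | zero => simp
    | succ p ih =>
      have hi : gradeInv (ExteriorAlgebra.ι ℂ (v 0)) = -ExteriorAlgebra.ι ℂ (v 0) :=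
        CliffordAlgebra.involute_ι _
      rw [ExteriorAlgebra.ιMulti_succ_apply, map_mul, ih, hi, pow_succ]
      simp

theorem contract_ιMulti (l : Module.Dual ℂ V) {p : ℕ} (v : Fin (p + 1) → V) :
    contract l (ExteriorAlgebra.ιMulti ℂ (p + 1) v) =
      ∑ k : Fin (p + 1), ((-1) ^ (k : ℕ) * l (v k)) •
        ExteriorAlgebra.ιMulti ℂ p (k.removeNth v) := by
  induction p with
  | zero =>
    rw [ExteriorAlgebra.ιMulti_succ_apply, contract_ι_mul]
    simp [CliffordAlgebra.contractLeft_one]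
  | succ p ih =>
    rw [ExteriorAlgebra.ιMulti_succ_apply, contract_ι_mul, ih]
    conv_rhs => rw [Fin.sum_univ_succ]
    have h0 : (Fin.removeNth 0 v : Fin (p + 1) → V) = Matrix.vecTail v := rfl
    have hk : ∀ k : Fin (p + 1), ExteriorAlgebra.ιMulti ℂ (p + 1) (k.succ.removeNth v) =
        ExteriorAlgebra.ι ℂ (v 0) *
          ExteriorAlgebra.ιMulti ℂ p (k.removeNth (Matrix.vecTail v)) := by
      intro k
      rw [ExteriorAlgebra.ιMulti_succ_apply]
      congr 2
      ext j
      simp [Matrix.vecTail, Fin.removeNth]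
    simp only [h0, hk, Finset.mul_sum, Fin.val_succ, Fin.val_zero, pow_zero, one_mul,
      sub_eq_add_neg, ← Finset.sum_neg_distrib]
    congr 1
    refine Finset.sum_congr rfl fun k _ => ?_
    rw [mul_smul_comm, pow_succ, ← neg_smul]
    congr 1
    simp [Matrix.vecTail]

theorem contract_mem (l : Module.Dual ℂ V) {p : ℕ} {u : ExteriorAlgebra ℂ V}
    (hu : u ∈ ⋀[ℂ]^(p + 1) V) : contract l u ∈ ⋀[ℂ]^p V := by
  rw [← ExteriorAlgebra.ιMulti_span_fixedDegree] at hu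
  induction hu using Submodule.span_induction with
  | zero => rw [map_zero]; exact zero_mem _
  | add x y _ _ hx hy => rw [map_add]; exact add_mem hx hy
  | smul c x _ hx => rw [map_smul]; exact Submodule.smul_mem _ _ hx
  | mem x hx =>
    obtain ⟨v, rfl⟩ := hx
    rw [contract_ιMulti]
    exact Submodule.sum_mem _ fun k _ => Submodule.smul_mem _ _
      (ExteriorAlgebra.ιMulti_range ℂ p ⟨_, rfl⟩)

theorem contract_of_mem_zero (l : Module.Dual ℂ V) {u : ExteriorAlgebra ℂ V}
    (hu : u ∈ ⋀[ℂ]^0 V) : contract l u = 0 := by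
  rw [← ExteriorAlgebra.ιMulti_span_fixedDegree] at hu
  induction hu using Submodule.span_induction with
  | zero => simp
  | add x y _ _ hx hy => rw [map_add, hx, hy, add_zero]
  | smul c x _ hx => rw [map_smul, hx, smul_zero]
  | mem x hx =>
    obtain ⟨v, rfl⟩ := hx
    simp [CliffordAlgebra.contractLeft_one]

theorem gradeInv_contract (l : Module.Dual ℂ V) (u : ExteriorAlgebra ℂ V) :
    gradeInv (contract l u) = -contract l (gradeInv u) := by
  induction u using CliffordAlgebra.left_induction with
  | algebraMap r => simp [CliffordAlgebra.contractLeft_algebraMap]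
  | add x y hx hy => rw [map_add, map_add, hx, hy, map_add, map_add, neg_add]
  | ι_mul u m h =>
    change gradeInv (contract l (ExteriorAlgebra.ι ℂ m * u)) =
      -contract l (gradeInv (ExteriorAlgebra.ι ℂ m * u))
    have hi : gradeInv (ExteriorAlgebra.ι ℂ m) = -ExteriorAlgebra.ι ℂ m :=
      CliffordAlgebra.involute_ι m
    rw [contract_ι_mul, map_mul, map_sub, map_mul, hi, h, neg_mul, neg_mul, map_neg,
      contract_ι_mul, map_smul]
    noncomm_ring

theorem contract_map {W : Type*} [AddCommGroup W] [Module ℂ W] (g : V →ₗ[ℂ] W)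
    (l : Module.Dual ℂ W) (u : ExteriorAlgebra ℂ V) :
    contract l (ExteriorAlgebra.map g u) = ExteriorAlgebra.map g (contract (l ∘ₗ g) u) := by
  induction u using CliffordAlgebra.left_induction with
  | algebraMap r =>
    change contract l (ExteriorAlgebra.map g (algebraMap ℂ (ExteriorAlgebra ℂ V) r)) =
      ExteriorAlgebra.map g (contract (l ∘ₗ g) (algebraMap ℂ (ExteriorAlgebra ℂ V) r))
    rw [AlgHom.commutes, Algebra.algebraMap_eq_smul_one, Algebra.algebraMap_eq_smul_one]
    simp [CliffordAlgebra.contractLeft_one]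
  | add x y hx hy => simp only [map_add, hx, hy]
  | ι_mul u m h =>
    change contract l (ExteriorAlgebra.map g (ExteriorAlgebra.ι ℂ m * u)) =
      ExteriorAlgebra.map g (contract (l ∘ₗ g) (ExteriorAlgebra.ι ℂ m * u))
    rw [map_mul, ExteriorAlgebra.map_apply_ι, contract_ι_mul, contract_ι_mul, h]
    simp

/-- The number operator: `∑ bᵢ ∧ (bᵢ* ⌟ u) = p u` in degree `p`. -/
theorem sum_ι_mul_contract {I : Type*} [Fintype I] (b : Module.Basis I ℂ V) {p : ℕ}
    {u : ExteriorAlgebra ℂ V} (hu : u ∈ ⋀[ℂ]^p V) :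
    ∑ i, ExteriorAlgebra.ι ℂ (b i) * contract (b.coord i) u = (p : ℂ) • u := by
  rw [← ExteriorAlgebra.ιMulti_span_fixedDegree] at hu
  induction hu using Submodule.span_induction with
  | zero => simp
  | add x y _ _ hx hy => simp only [map_add, mul_add, Finset.sum_add_distrib, hx, hy, smul_add]
  | smul c x _ hx => simp only [map_smul, mul_smul_comm, ← Finset.smul_sum, hx, smul_comm c]
  | mem x hx =>
    obtain ⟨v, rfl⟩ := hx
    induction p with
    | zero => simp [CliffordAlgebra.contractLeft_one]
    | succ p ih =>
      have hc : ∀ i, ExteriorAlgebra.ι ℂ (b i) *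
          (ExteriorAlgebra.ι ℂ (v 0) * contract (b.coord i)
            (ExteriorAlgebra.ιMulti ℂ p (Matrix.vecTail v))) =
          -(ExteriorAlgebra.ι ℂ (v 0) * (ExteriorAlgebra.ι ℂ (b i) * contract (b.coord i)
            (ExteriorAlgebra.ιMulti ℂ p (Matrix.vecTail v)))) := by
        intro i
        rw [← mul_assoc, ι_mul_ι_eq_neg, neg_mul, mul_assoc]
      have hs : ∑ i, b.coord i (v 0) • ExteriorAlgebra.ι ℂ (b i) = ExteriorAlgebra.ι ℂ (v 0) := by
        simp only [← map_smul, ← map_sum]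
        congr 1
        exact b.sum_repr (v 0)
      simp only [ExteriorAlgebra.ιMulti_succ_apply, contract_ι_mul, mul_sub, mul_smul_comm, hc, sub_neg_eq_add,
        Finset.sum_add_distrib, ← smul_mul_assoc, ← Finset.sum_mul,
        ← Finset.mul_sum, hs, ih]
      push_cast
      rw [add_smul, one_smul, add_comm, add_mul, smul_mul_assoc]

/-- Integration by parts. It will be applied when the degrees of u and w add up to more than dim V.
-/
theorem contract_mul_of_mul_eq_zero (l : Module.Dual ℂ V) {u w : ExteriorAlgebra ℂ V}
    (h : u * w = 0) : contract l u * w = -(gradeInv u * contract l w) := by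
  have := contract_mul l u w
  rw [h, map_zero] at this
  exact eq_neg_of_add_eq_zero_left this.symm

theorem eq_zero_of_mem_of_finrank_lt [FiniteDimensional ℂ V] {m : ℕ}
    (hm : Module.finrank ℂ V < m) {u : ExteriorAlgebra ℂ V} (hu : u ∈ ⋀[ℂ]^m V) : u = 0 := by
  have h0 : Module.finrank ℂ (⋀[ℂ]^m V) = 0 := by
    rw [exteriorPower.finrank_eq, Nat.choose_eq_zero_of_lt hm]
  have := Module.finrank_zero_iff.1 h0
  exact congrArg Subtype.val (Subsingleton.elim (⟨u, hu⟩ : ⋀[ℂ]^m V) 0)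

theorem mul_mem_exteriorPower {p q m : ℕ} (h : p + q = m) {u w : ExteriorAlgebra ℂ V}
    (hu : u ∈ ⋀[ℂ]^p V) (hw : w ∈ ⋀[ℂ]^q V) : u * w ∈ ⋀[ℂ]^m V := by
  subst h
  exact SetLike.mul_mem_graded hu hw

theorem ι_mem_exteriorPower_one (x : V) : ExteriorAlgebra.ι ℂ x ∈ ⋀[ℂ]^1 V := by
  simp

/-- The product `⋀^p V × ⋀^q V → ⋀^n V`, `p + q = n = dim V`, is nondegenerate. -/
theorem eq_zero_of_forall_mul_eq_zero [FiniteDimensional ℂ V] {p q : ℕ}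
    (h : p + q = Module.finrank ℂ V) {w : ExteriorAlgebra ℂ V} (hw : w ∈ ⋀[ℂ]^q V)
    (h0 : ∀ u ∈ ⋀[ℂ]^p V, u * w = 0) : w = 0 := by
  induction p generalizing q w with
  | zero =>
    have := h0 1 (by simp)
    rwa [one_mul] at this
  | succ p ih =>
    -- Every x ∧ w is annihilated by ⋀^p, since u ∧ x has degree p + 1; the induction hypothesis
    -- applies to it.
    have hx : ∀ x : V, ExteriorAlgebra.ι ℂ x * w = 0 := by
      intro x
      refine ih (q := q + 1) (by omega)
        (mul_mem_exteriorPower (add_comm 1 q) (ι_mem_exteriorPower_one x) hw) fun u hu => ?_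
      rw [← mul_assoc]
      exact h0 _ (mul_mem_exteriorPower rfl hu (ι_mem_exteriorPower_one x))
    let b := Module.finBasis ℂ V
    have h1 : ∀ i, ExteriorAlgebra.ι ℂ (b i) * contract (b.coord i) w = w := by
      intro i
      have := contract_ι_mul (b.coord i) (b i) w
      rw [hx, map_zero] at this
      simpa using (sub_eq_zero.1 this.symm).symm
    -- Contracting b_i ∧ w = 0 by b_i* gave b_i ∧ (b_i* ⌟ w) = w. Summed over i, the number operator
    -- yields n w = q w, while n - q = p + 1 is not zero.
    have h2 := sum_ι_mul_contract b hw
    simp only [h1, Finset.sum_const, Finset.card_univ, Fintype.card_fin] at h2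
    rw [← Nat.cast_smul_eq_nsmul ℂ, ← sub_eq_zero, ← sub_smul, ← h] at h2
    refine (smul_eq_zero.1 h2).resolve_left ?_
    push_cast
    rw [add_sub_cancel_right]
    exact_mod_cast Nat.succ_ne_zero p

/-- A linear form on the exterior algebra that does not vanish on the top degree. -/
theorem exists_volumeForm (V : Type*) [AddCommGroup V] [Module ℂ V] [FiniteDimensional ℂ V] :
    ∃ Ω : ExteriorAlgebra ℂ V →ₗ[ℂ] ℂ, ∀ u ∈ ⋀[ℂ]^(Module.finrank ℂ V) V, Ω u = 0 → u = 0 := by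
  have h1 : Module.finrank ℂ (⋀[ℂ]^(Module.finrank ℂ V) V) = Module.finrank ℂ ℂ := by
    rw [exteriorPower.finrank_eq, Nat.choose_self, Module.finrank_self]
  let g := LinearEquiv.ofFinrankEq _ _ h1
  obtain ⟨Ω, hΩ⟩ := LinearMap.exists_extend (g : (⋀[ℂ]^(Module.finrank ℂ V) V) →ₗ[ℂ] ℂ)
  refine ⟨Ω, fun u hu h => ?_⟩
  have : g ⟨u, hu⟩ = 0 := by
    rw [← h]
    exact (congrArg (fun k => k ⟨u, hu⟩) hΩ).symm
  exact congrArg Subtype.val ((LinearEquiv.map_eq_zero_iff g).1 this)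

theorem map_mem_exteriorPower {W : Type*} [AddCommGroup W] [Module ℂ W] (g : W →ₗ[ℂ] V) {p : ℕ}
    {u : ExteriorAlgebra ℂ W} (hu : u ∈ ⋀[ℂ]^p W) : ExteriorAlgebra.map g u ∈ ⋀[ℂ]^p V := by
  rw [← ExteriorAlgebra.ιMulti_span_fixedDegree] at hu
  induction hu using Submodule.span_induction with
  | zero => rw [map_zero]; exact zero_mem _
  | add x y _ _ hx hy => rw [map_add]; exact add_mem hx hy
  | smul c x _ hx => rw [map_smul]; exact Submodule.smul_mem _ _ hx
  | mem x hx =>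
    obtain ⟨v, rfl⟩ := hx
    rw [ExteriorAlgebra.map_apply_ιMulti]
    exact ExteriorAlgebra.ιMulti_range ℂ p ⟨_, rfl⟩

/-- The perfect pairing between `⋀^p V` and `⋀^q V` for `p + q = dim V`. -/
theorem exists_pairing {W : Type*} [AddCommGroup W] [Module ℂ W] [FiniteDimensional ℂ V]
    (τ : W ≃ₗ[ℂ] V) {Ω : ExteriorAlgebra ℂ V →ₗ[ℂ] ℂ}
    (hΩ : ∀ u ∈ ⋀[ℂ]^(Module.finrank ℂ V) V, Ω u = 0 → u = 0) {p q : ℕ}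
    (h : p + q = Module.finrank ℂ V) :
    ∃ β : ⋀[ℂ]^q W ≃ₗ[ℂ] Module.Dual ℂ (⋀[ℂ]^p V),
      ∀ w u, β w u = Ω (u * ExteriorAlgebra.map (τ : W →ₗ[ℂ] V) w) := by
  have : FiniteDimensional ℂ W := τ.symm.finiteDimensional
  let m : ⋀[ℂ]^q W →ₗ[ℂ] Module.Dual ℂ (⋀[ℂ]^p V) :=
    ((LinearMap.mul ℂ (ExteriorAlgebra ℂ V)).compr₂ Ω).flip.compl₁₂
      ((ExteriorAlgebra.map (τ : W →ₗ[ℂ] V)).toLinearMap ∘ₗ (⋀[ℂ]^q W).subtype)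
      (⋀[ℂ]^p V).subtype
  have hm : ∀ w u, m w u = Ω (u * ExteriorAlgebra.map (τ : W →ₗ[ℂ] V) w) := fun _ _ => rfl
  have hinj : Function.Injective m := by
    rw [injective_iff_map_eq_zero]
    intro w hw
    have hw' : ExteriorAlgebra.map (τ : W →ₗ[ℂ] V) (w : ExteriorAlgebra ℂ W) ∈ ⋀[ℂ]^q V :=
      map_mem_exteriorPower _ w.2
    have := eq_zero_of_forall_mul_eq_zero h hw' fun u hu =>
      hΩ _ (mul_mem_exteriorPower h hu hw') (by rw [← hm w ⟨u, hu⟩, hw]; rfl)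
    have hτ : Function.Injective (ExteriorAlgebra.map (τ : W →ₗ[ℂ] V)) :=
      ExteriorAlgebra.map_injective ⟨τ.symm, by ext; simp⟩
    exact Subtype.ext (hτ (this.trans (map_zero _).symm))
  have hdim : Module.finrank ℂ (⋀[ℂ]^q W) = Module.finrank ℂ (Module.Dual ℂ (⋀[ℂ]^p V)) := by
    rw [Subspace.dual_finrank_eq, exteriorPower.finrank_eq, exteriorPower.finrank_eq,
      τ.finrank_eq, ← h, Nat.choose_symm_add]
  exact ⟨m.linearEquivOfInjective hinj hdim, hm⟩

end Contraction

/-! ### The boundary map in terms of contractions -/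

section ContractPow

variable {V : Type*} [AddCommGroup V] [Module ℂ V]

/-- The contraction by a linear form, from `⋀^(p+1) V` to `⋀^p V`. -/
def contractPow (l : Module.Dual ℂ V) (p : ℕ) : ⋀[ℂ]^(p + 1) V →ₗ[ℂ] ⋀[ℂ]^p V :=
  (contract l).restrict fun _ => contract_mem l

@[simp]
theorem coe_contractPow (l : Module.Dual ℂ V) (p : ℕ) (u : ⋀[ℂ]^(p + 1) V) :
    (contractPow l p u : ExteriorAlgebra ℂ V) = contract l u := rfl

theorem contractPow_ιMulti (l : Module.Dual ℂ V) {p : ℕ} (v : Fin (p + 1) → V) :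
    contractPow l p (exteriorPower.ιMulti ℂ (p + 1) v) =
      ∑ k : Fin (p + 1), ((-1) ^ (k : ℕ) * l (v k)) •
        exteriorPower.ιMulti ℂ p (k.removeNth v) := by
  ext
  rw [coe_contractPow, exteriorPower.ιMulti_apply_coe, contract_ιMulti]
  simp

/-- Converts the alternating sums defining the differential into sums over a basis: linearity of F
reassembles v_k from its coordinates. -/
theorem sum_apply_contractPow_ιMulti {N I : Type*} [AddCommGroup N] [Module ℂ N] [Fintype I]
    (b : Module.Basis I ℂ V) {p : ℕ} (F : V →ₗ[ℂ] ⋀[ℂ]^p V →ₗ[ℂ] N) (v : Fin (p + 1) → V) :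
    ∑ i, F (b i) (contractPow (b.coord i) p (exteriorPower.ιMulti ℂ (p + 1) v)) =
      ∑ k : Fin (p + 1), (-1 : ℤ) ^ (k : ℕ) • F (v k) (exteriorPower.ιMulti ℂ p (k.removeNth v)) := by
  simp only [contractPow_ιMulti, map_sum, map_smul]
  rw [Finset.sum_comm]
  refine Finset.sum_congr rfl fun k _ => ?_
  conv_rhs => rw [← b.sum_repr (v k)]
  simp only [map_sum, map_smul, LinearMap.sum_apply, LinearMap.smul_apply, Finset.smul_sum]
  refine Finset.sum_congr rfl fun i _ => ?_
  rw [mul_smul, ← Int.cast_smul_eq_zsmul ℂ]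
  simp

end ContractPow

/-! ### The bracket term, its transpose and the opposite algebra. -/

section Bracket

variable {L : Type*} [LieRing L] [LieAlgebra ℂ L] {I : Type*} [Fintype I]

/-- The extension of `bracketPart` to the exterior algebra, in terms of a basis. -/
def bracketOp (b : Module.Basis I ℂ L) : ExteriorAlgebra ℂ L →ₗ[ℂ] ExteriorAlgebra ℂ L :=
  (-(1 / 2) : ℂ) • ∑ i, ∑ j, LinearMap.mulLeft ℂ (ExteriorAlgebra.ι ℂ ⁅b i, b j⁆) ∘ₗ
    contract (b.coord j) ∘ₗ contract (b.coord i)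

theorem bracketOp_apply (b : Module.Basis I ℂ L) (u : ExteriorAlgebra ℂ L) :
    bracketOp b u = (-(1 / 2) : ℂ) • ∑ i, ∑ j, ExteriorAlgebra.ι ℂ ⁅b i, b j⁆ *
      contract (b.coord j) (contract (b.coord i) u) := by
  simp [bracketOp]

/-- The double alternating sum is converted one index at a time, `F` handling the outer index and
`G` the inner one. In degree one both sides vanish, as two contractions kill ⋀^1. -/
theorem coe_bracketPart (b : Module.Basis I ℂ L) (p : ℕ) (u : ⋀[ℂ]^(p + 1) L) :
    (bracketPart L p u : ExteriorAlgebra ℂ L) = bracketOp b u := by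
  cases p with
  | zero =>
    have h : ∀ i j, contract (b.coord j) (contract (b.coord i) (u : ExteriorAlgebra ℂ L)) = 0 :=
      fun i j => contract_of_mem_zero _ (contract_mem _ u.2)
    simp [bracketOp_apply, h, bracketPart]
  | succ p =>
    have : (⋀[ℂ]^(p + 1) L).subtype ∘ₗ bracketPart L (p + 1) =
        bracketOp b ∘ₗ (⋀[ℂ]^(p + 2) L).subtype := by
      apply exteriorPower.linearMap_ext
      ext v
      let G : L →ₗ[ℂ] L →ₗ[ℂ] ⋀[ℂ]^p L →ₗ[ℂ] ExteriorAlgebra ℂ L :=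
        ((LieAlgebra.ad ℂ L : L →ₗ⁅ℂ⁆ Module.End ℂ L) : L →ₗ[ℂ] Module.End ℂ L).compr₂
          ((LinearMap.mul ℂ (ExteriorAlgebra ℂ L)).compl₁₂ (ExteriorAlgebra.ι ℂ)
            (⋀[ℂ]^p L).subtype)
      have hG : ∀ x y w, G x y w = ExteriorAlgebra.ι ℂ ⁅x, y⁆ * w := fun _ _ _ => rfl
      let F : L →ₗ[ℂ] ⋀[ℂ]^(p + 1) L →ₗ[ℂ] ExteriorAlgebra ℂ L :=
        ∑ j, ((LinearMap.lcomp ℂ _ (contractPow (b.coord j) p)) ∘ₗ G.flip (b j))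
      have hF : ∀ x w, F x w = ∑ j, ExteriorAlgebra.ι ℂ ⁅x, b j⁆ * contract (b.coord j) w := by
        intro x w
        simp [F, LinearMap.sum_apply, hG]
      have h1 : bracketOp b (exteriorPower.ιMulti ℂ (p + 2) v : ExteriorAlgebra ℂ L) =
          (-(1 / 2) : ℂ) • ∑ i, F (b i) (contractPow (b.coord i) (p + 1)
            (exteriorPower.ιMulti ℂ (p + 2) v)) := by
        rw [bracketOp_apply]
        simp only [hF, coe_contractPow]
      have h2 : ∀ x w, F x (exteriorPower.ιMulti ℂ (p + 1) w) =
          ∑ l : Fin (p + 1), (-1 : ℤ) ^ (l : ℕ) •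
            (ExteriorAlgebra.ι ℂ ⁅x, w l⁆ * ExteriorAlgebra.ιMulti ℂ p (l.removeNth w)) := by
        intro x w
        have := sum_apply_contractPow_ιMulti b (G x) w
        simp only [hG, coe_contractPow, exteriorPower.ιMulti_apply_coe] at this
        rw [hF, exteriorPower.ιMulti_apply_coe, this]
      change _ = bracketOp b (exteriorPower.ιMulti ℂ (p + 2) v : ExteriorAlgebra ℂ L)
      rw [h1, sum_apply_contractPow_ιMulti b F]
      simp only [h2]
      simp [bracketPart, AlternatingMap.alternatizeUncurryFin_apply, bracketForm,
        ExteriorAlgebra.ιMulti_succ_apply]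
    exact congrArg (fun g => g u) this

theorem sum_coord_lie (b : Module.Basis I ℂ L) (x : L) :
    ∑ j, b.coord j ⁅x, b j⁆ = LinearMap.trace ℂ L (LieAlgebra.ad ℂ L x) := by
  classical
  rw [LinearMap.trace_eq_matrix_trace ℂ b, Matrix.trace]
  simp [LinearMap.toMatrix_apply]

/-- The only use of nilpotency; the duality itself needs just tr(ad x) = 0. -/
theorem trace_ad_eq_zero [FiniteDimensional ℂ L] [LieRing.IsNilpotent L] (x : L) :
    LinearMap.trace ℂ L (LieAlgebra.ad ℂ L x) = 0 := by
  have h : IsNilpotent (LieAlgebra.ad ℂ L x) :=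
    LieModule.isNilpotent_toEnd_of_isNilpotent ℂ L L x
  exact (LinearMap.isNilpotent_trace_of_isNilpotent h).eq_zero

/-- On a Lie algebra with `tr (ad x) = 0`, the operator `bracketOp` is, up to sign, its own
transpose. -/
theorem bracketOp_mul [FiniteDimensional ℂ L]
    (htr : ∀ x : L, LinearMap.trace ℂ L (LieAlgebra.ad ℂ L x) = 0)
    (b : Module.Basis I ℂ L) {p q : ℕ} (h : p + q + 1 = Module.finrank ℂ L)
    {u w : ExteriorAlgebra ℂ L} (hu : u ∈ ⋀[ℂ]^(p + 1) L) (hw : w ∈ ⋀[ℂ]^(q + 1) L) :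
    bracketOp b u * w = gradeInv u * bracketOp b w := by
  have hu' : gradeInv u ∈ ⋀[ℂ]^(p + 1) L := by
    rw [gradeInv_of_mem hu]
    exact Submodule.smul_mem _ _ hu
  have hz : ∀ {s t : ℕ} {x y : ExteriorAlgebra ℂ L}, x ∈ ⋀[ℂ]^s L → y ∈ ⋀[ℂ]^t L →
      Module.finrank ℂ L < s + t → x * y = 0 := fun hx hy hlt =>
    eq_zero_of_mem_of_finrank_lt hlt (mul_mem_exteriorPower rfl hx hy)
  -- The vector [b_i, b_j] is moved past the contracted u, then each contraction is integrated by
  -- parts; the products dropped have degree n + 1.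
  have key : ∀ i j, ExteriorAlgebra.ι ℂ ⁅b i, b j⁆ *
      contract (b.coord j) (contract (b.coord i) u) * w =
      -(gradeInv u * contract (b.coord i) (contract (b.coord j)
        (ExteriorAlgebra.ι ℂ ⁅b i, b j⁆ * w))) := by
    intro i j
    have hW : ExteriorAlgebra.ι ℂ ⁅b i, b j⁆ * w ∈ ⋀[ℂ]^(q + 1 + 1) L :=
      mul_mem_exteriorPower (add_comm _ _) (ι_mem_exteriorPower_one _) hw
    rw [ι_mul_eq_gradeInv_mul_ι, mul_assoc, gradeInv_contract, gradeInv_contract, map_neg,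
      neg_neg, contract_mul_of_mul_eq_zero _ (hz (contract_mem _ hu') hW (by omega)),
      gradeInv_contract, neg_mul, neg_neg, CliffordAlgebra.involute_involute,
      contract_mul_of_mul_eq_zero _ (hz hu (contract_mem _ hW) (by omega))]
  have hexp : ∀ i j, contract (b.coord i) (contract (b.coord j)
        (ExteriorAlgebra.ι ℂ ⁅b i, b j⁆ * w)) =
      b.coord j ⁅b i, b j⁆ • contract (b.coord i) w +
      b.coord i ⁅b j, b i⁆ • contract (b.coord j) w -
      ExteriorAlgebra.ι ℂ ⁅b i, b j⁆ * contract (b.coord j) (contract (b.coord i) w) := by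
    intro i j
    rw [contract_ι_mul, map_sub, map_smul, contract_ι_mul, ← lie_skew (b i) (b j), map_neg,
      CliffordAlgebra.contractLeft_comm (b.coord i) (b.coord j) w]
    simp only [map_neg, neg_smul, neg_mul, mul_neg, neg_neg]
    abel
  -- Contracting [b_i, b_j] itself produces the coefficients ∑_j b_j*([b_i, b_j]) = tr(ad b_i),
  -- which vanish; only the terms with both contractions on w remain.
  have hsum : ∑ i, ∑ j, contract (b.coord i) (contract (b.coord j)
        (ExteriorAlgebra.ι ℂ ⁅b i, b j⁆ * w)) =
      -∑ i, ∑ j, ExteriorAlgebra.ι ℂ ⁅b i, b j⁆ *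
        contract (b.coord j) (contract (b.coord i) w) := by
    simp only [hexp, Finset.sum_sub_distrib, Finset.sum_add_distrib]
    rw [Finset.sum_comm (f := fun i j => b.coord i ⁅b j, b i⁆ • contract (b.coord j) w)]
    simp only [← Finset.sum_smul, sum_coord_lie, htr]
    simp
  rw [bracketOp_apply, bracketOp_apply, smul_mul_assoc, mul_smul_comm]
  congr 1
  simp only [Finset.sum_mul, key, Finset.sum_neg_distrib, ← Finset.mul_sum, hsum, mul_neg, neg_neg]

/-- Passing to the opposite Lie algebra changes the sign of `bracketPart`. -/
theorem map_bracketPart_opposite (b : Module.Basis I ℂ L) (p : ℕ)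
    (w : ⋀[ℂ]^(p + 1) (OppositeLie L)) :
    ExteriorAlgebra.map (ofOpposite L : OppositeLie L →ₗ[ℂ] L)
        (bracketPart (OppositeLie L) p w : ExteriorAlgebra ℂ (OppositeLie L)) =
      -bracketOp b (ExteriorAlgebra.map (ofOpposite L : OppositeLie L →ₗ[ℂ] L) w) := by
  rw [coe_bracketPart (b.map (ofOpposite L).symm), bracketOp_apply, bracketOp_apply, map_smul,
    ← smul_neg]
  congr 1
  simp only [map_sum, ← Finset.sum_neg_distrib]
  refine Finset.sum_congr rfl fun i _ => Finset.sum_congr rfl fun j _ => ?_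
  have hcoord : ∀ i, (b.map (ofOpposite L).symm).coord i =
      b.coord i ∘ₗ (ofOpposite L : OppositeLie L →ₗ[ℂ] L) := by
    intro i
    ext x
    simp
  rw [map_mul, hcoord, hcoord, contract_map, contract_map, ExteriorAlgebra.map_apply_ι,
    LinearEquiv.coe_coe, ofOpposite_lie, ← lie_skew, map_neg, neg_mul]
  simp

end Bracket

/-! ### The full differential in a basis. -/

section Boundary

variable {E L : Type*} [NormedAddCommGroup E] [NormedSpace ℂ E] [LieRing L] [LieAlgebra ℂ L]
  {I : Type*} [Fintype I]

theorem boundary_tmul (ρ : L →ₗ⁅ℂ⁆ (E →L[ℂ] E)ᵐᵒᵖ) (f : Module.Dual ℂ L) (p : ℕ)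
    (b : Module.Basis I ℂ L) (e : E) (u : ⋀[ℂ]^(p + 1) L) :
    boundary ρ f p (e ⊗ₜ u) =
      ∑ i, shifted ρ f (b i) e ⊗ₜ contractPow (b.coord i) p u + e ⊗ₜ bracketPart L p u := by
  let S : L →ₗ[ℂ] E :=
    { toFun := fun x => shifted ρ f x e
      map_add' := fun x y => by simp [shifted, add_smul]; abel
      map_smul' := fun c x => by simp [shifted, mul_smul, smul_sub] }
  let F : L →ₗ[ℂ] ⋀[ℂ]^p L →ₗ[ℂ] E ⊗[ℂ] ⋀[ℂ]^p L := TensorProduct.mk ℂ E (⋀[ℂ]^p L) ∘ₗ S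
  have hF : ∀ x w, F x w = shifted ρ f x e ⊗ₜ w := fun _ _ => rfl
  have h : ((exteriorPower.alternatingMapLinearEquiv
      (AlternatingMap.alternatizeUncurryFin (actionForm ρ f p))).flip e) =
      ∑ i, F (b i) ∘ₗ contractPow (b.coord i) p := by
    apply exteriorPower.linearMap_ext
    ext v
    simp only [LinearMap.compAlternatingMap_apply, LinearMap.sum_apply, LinearMap.comp_apply]
    rw [sum_apply_contractPow_ιMulti b F]
    simp [AlternatingMap.alternatizeUncurryFin_apply, actionForm, hF]
  have := congrArg (fun g => g u) h
  simp only [LinearMap.sum_apply, LinearMap.comp_apply, hF] at this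
  rw [← this]
  simp [boundary]

end Boundary

/-! ### Coordinates on `E ⊗ V` -/

section Coords

variable {E V : Type*} [NormedAddCommGroup E] [NormedSpace ℂ E] [AddCommGroup V] [Module ℂ V]
  {ι : Type*} [Fintype ι] [DecidableEq ι]

/-- The identification of `E ⊗ V` with a power of `E` given by a basis of `V`. -/
def coords (E : Type*) [NormedAddCommGroup E] [NormedSpace ℂ E] (b : Module.Basis ι ℂ V) :
    E ⊗[ℂ] V ≃ₗ[ℂ] (ι → E) :=
  b.equivFun.lTensor E ≪≫ₗ TensorProduct.piScalarRight ℂ ℂ E ι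

@[simp]
theorem coords_tmul (b : Module.Basis ι ℂ V) (e : E) (v : V) (i : ι) :
    coords E b (e ⊗ₜ v) i = b.repr v i • e := by
  simp [coords]

theorem coords_symm_single (b : Module.Basis ι ℂ V) (i : ι) (e : E) :
    (coords E b).symm (Pi.single i e) = e ⊗ₜ b i := by
  rw [LinearEquiv.symm_apply_eq]
  ext j
  rw [coords_tmul, b.repr_self]
  by_cases h : i = j
  · subst h
    simp
  · simp [Ne.symm h]

theorem rid_lTensor_eq_sum (b : Module.Basis ι ℂ V) (l : Module.Dual ℂ V) (t : E ⊗[ℂ] V) :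
    TensorProduct.rid ℂ E (l.lTensor E t) = ∑ i, l (b i) • coords E b t i := by
  induction t with
  | zero => simp
  | add x y hx hy => simp only [map_add, Pi.add_apply, smul_add, Finset.sum_add_distrib, hx, hy]
  | tmul e v =>
    simp only [LinearMap.lTensor_tmul, TensorProduct.rid_tmul, coords_tmul, smul_smul,
      ← Finset.sum_smul]
    congr 1
    conv_lhs => rw [← b.sum_repr v, map_sum]
    simp only [map_smul, smul_eq_mul, mul_comm]

/-- Each coordinate is one of the maps id ⊗ φ, and each id ⊗ φ is a finite linear combination of
coordinates. -/
theorem tensorTopology_eq_induced (b : Module.Basis ι ℂ V) :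
    tensorTopology E V = TopologicalSpace.induced (coords E b) inferInstance := by
  apply le_antisymm
  · rw [← continuous_iff_le_induced]
    refine @continuous_pi _ _ _ (tensorTopology E V) _ _ fun i => ?_
    have hi : (fun t => coords E b t i) =
        fun t => TensorProduct.rid ℂ E ((b.coord i).lTensor E t) := by
      ext t
      rw [rid_lTensor_eq_sum b]
      simp [Finsupp.single_apply]
    rw [hi, continuous_iff_le_induced]
    exact iInf_le _ (b.coord i)
  · refine le_iInf fun l => ?_
    rw [← continuous_iff_le_induced]
    have h1 : @Continuous _ _ (TopologicalSpace.induced (coords E b) inferInstance) _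
      (coords E b) := continuous_induced_dom
    have h2 : Continuous fun x : ι → E => ∑ i, l (b i) • x i := by fun_prop
    have h3 : (fun t => TensorProduct.rid ℂ E (l.lTensor E t)) =
        (fun x : ι → E => ∑ i, l (b i) • x i) ∘ coords E b :=
      funext (rid_lTensor_eq_sum b l)
    rw [h3]
    exact @Continuous.comp _ _ _ (_) _ _ _ _ h2 h1

theorem isClosed_tensorTopology_iff (b : Module.Basis ι ℂ V) (S : Set (E ⊗[ℂ] V)) :
    IsClosed[tensorTopology E V] S ↔ IsClosed (coords E b '' S) := by
  rw [tensorTopology_eq_induced b, isClosed_induced_iff]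
  constructor
  · rintro ⟨t, ht, rfl⟩
    rwa [Set.image_preimage_eq _ (coords E b).surjective]
  · intro h
    exact ⟨_, h, Set.preimage_image_eq _ (coords E b).injective⟩

theorem continuous_of_comp_single {F : Type*} [NormedAddCommGroup F] [NormedSpace ℂ F]
    (g : (ι → E) →ₗ[ℂ] F) (h : ∀ i, Continuous fun e => g (Pi.single i e)) : Continuous g := by
  have : (g : (ι → E) → F) = fun x => ∑ i, g (Pi.single i (x i)) := by
    ext x
    rw [← map_sum, Finset.univ_sum_single]
  rw [this]
  exact continuous_finsetSum _ fun i _ => (h i).comp (continuous_apply i)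

/-- The dual space of a finite power of `E` is the same power of the dual space. -/
def piDual (E ι : Type*) [NormedAddCommGroup E] [NormedSpace ℂ E] [Fintype ι] [DecidableEq ι] :
    (ι → StrongDual ℂ E) ≃L[ℂ] StrongDual ℂ (ι → E) where
  toFun φ := ∑ i, (φ i).comp (ContinuousLinearMap.proj i)
  invFun ψ i := ψ.comp (ContinuousLinearMap.single ℂ (fun _ => E) i)
  map_add' φ φ' := by
    ext
    simp [Finset.sum_add_distrib]
  map_smul' c φ := by
    ext
    simp [Finset.mul_sum]
  left_inv φ := by
    ext i e
    simp only [ContinuousLinearMap.comp_apply, sum_apply,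
      ContinuousLinearMap.single_apply, ContinuousLinearMap.proj_apply]
    rw [Finset.sum_eq_single i (fun j _ hj => by simp [hj]) (by simp), Pi.single_eq_same]
  right_inv ψ := by
    ext x
    simp only [ContinuousLinearMap.comp_apply, sum_apply,
      ContinuousLinearMap.single_apply, ContinuousLinearMap.proj_apply]
    rw [← map_sum, Finset.univ_sum_single]
  continuous_toFun := by
    refine continuous_finsetSum _ fun i _ => ?_
    exact (((ContinuousLinearMap.compL ℂ (ι → E) E ℂ).flip
      (ContinuousLinearMap.proj i)).continuous).comp (continuous_apply i)
  continuous_invFun := continuous_pi fun i =>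
    ((ContinuousLinearMap.compL ℂ E (ι → E) ℂ).flip
      (ContinuousLinearMap.single ℂ (fun _ => E) i)).continuous

theorem piDual_apply (φ : ι → StrongDual ℂ E) (x : ι → E) :
    piDual E ι φ x = ∑ i, φ i (x i) := by
  change (∑ i, (φ i).comp (ContinuousLinearMap.proj (R := ℂ) (φ := fun _ : ι => E) i)) x = _
  simp

/-- A perfect pairing of `V` and `W` identifies `E* ⊗ W` with the dual space of `E ⊗ V`. -/
theorem exists_dual_tensor_equiv {W : Type*} [AddCommGroup W] [Module ℂ W]
    (b : Module.Basis ι ℂ V) (β : W ≃ₗ[ℂ] Module.Dual ℂ V) :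
    ∃ Ψ : StrongDual ℂ E ⊗[ℂ] W ≃ₗ[ℂ] StrongDual ℂ (ι → E),
      (∀ φ w e v, Ψ (φ ⊗ₜ w) (coords E b (e ⊗ₜ v)) = φ e * β w v) ∧
      ∀ S, IsClosed[tensorTopology (StrongDual ℂ E) W] S ↔ IsClosed (Ψ '' S) := by
  -- The basis of W dual to b under β, so that the coordinates of w are the values β(w, b_i).
  let c : Module.Basis ι ℂ W := b.dualBasis.map β.symm
  have hc : ∀ w i, c.repr w i = β w (b i) := by
    intro w i
    simp [c]
  refine ⟨coords (StrongDual ℂ E) c ≪≫ₗ (piDual E ι).toLinearEquiv, fun φ w e v => ?_,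
    fun S => ?_⟩
  · change piDual E ι (coords (StrongDual ℂ E) c (φ ⊗ₜ w)) _ = _
    rw [piDual_apply]
    conv_rhs => rw [← b.sum_repr v]
    simp only [coords_tmul, hc, map_sum, map_smul, smul_eq_mul, smul_apply,
      Finset.mul_sum]
    exact Finset.sum_congr rfl fun i _ => by ring
  · rw [isClosed_tensorTopology_iff c]
    have : ((coords (StrongDual ℂ E) c ≪≫ₗ (piDual E ι).toLinearEquiv) '' S) =
        piDual E ι '' (coords (StrongDual ℂ E) c '' S) := by
      rw [Set.image_image]
      rfl
    rw [this]
    exact ((piDual E ι).toHomeomorph.isClosed_image (s := coords (StrongDual ℂ E) c '' S)).symm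

end Coords

/-! ### The differentials as bounded operators -/

section Differential

variable {E L : Type*} [NormedAddCommGroup E] [NormedSpace ℂ E] [LieRing L] [LieAlgebra ℂ L]
  [FiniteDimensional ℂ L]

/-- The Banach space underlying `E ⊗ ⋀^p L`. -/
abbrev Chain (E L : Type*) [NormedAddCommGroup E] [LieRing L] [LieAlgebra ℂ L] (p : ℕ) : Type _ :=
  Fin (Module.finrank ℂ (⋀[ℂ]^p L)) → E

/-- The coordinates on `E ⊗ ⋀^p L` with respect to a fixed basis. -/
def chainCoords (E L : Type*) [NormedAddCommGroup E] [NormedSpace ℂ E] [LieRing L]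
    [LieAlgebra ℂ L] [FiniteDimensional ℂ L] (p : ℕ) : E ⊗[ℂ] ⋀[ℂ]^p L ≃ₗ[ℂ] Chain E L p :=
  coords E (Module.finBasis ℂ (⋀[ℂ]^p L))

/-- On each summand E the coordinates are combinations of shifted operators and scalars. For p = 0
truncated subtraction makes the target degree 0, harmlessly since d_0 = 0. -/
theorem continuous_differential (ρ : L →ₗ⁅ℂ⁆ (E →L[ℂ] E)ᵐᵒᵖ) (f : Module.Dual ℂ L) (p : ℕ) :
    Continuous ((chainCoords E L (p - 1)).toLinearMap ∘ₗ differential ρ f p ∘ₗ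
      (chainCoords E L p).symm.toLinearMap) := by
  cases p with
  | zero => exact continuous_const
  | succ p =>
    refine continuous_of_comp_single _ fun i => continuous_pi fun j => ?_
    simp only [chainCoords, LinearMap.comp_apply, LinearEquiv.coe_coe, coords_symm_single,
      differential, boundary_tmul ρ f p (Module.finBasis ℂ L), map_add, map_sum, Pi.add_apply,
      Finset.sum_apply]
    have hs : ∀ x, Continuous (shifted ρ f x) := fun x =>
      (ρ x).unop.continuous.sub (continuous_const_smul (f x))
    refine (continuous_finsetSum _ fun k _ => ?_).add ?_
    · exact (continuous_congr fun e => coords_tmul _ _ _ _).2 ((hs _).const_smul _)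
    · exact (continuous_congr fun e => coords_tmul _ _ _ _).2 (continuous_const_smul _)

/-- The differential `d_p(f)` in coordinates. -/
def differentialOp (ρ : L →ₗ⁅ℂ⁆ (E →L[ℂ] E)ᵐᵒᵖ) (f : Module.Dual ℂ L) (p : ℕ) :
    Chain E L p →L[ℂ] Chain E L (p - 1) :=
  ⟨_, continuous_differential ρ f p⟩

theorem differentialOp_chainCoords (ρ : L →ₗ⁅ℂ⁆ (E →L[ℂ] E)ᵐᵒᵖ) (f : Module.Dual ℂ L) (p : ℕ)
    (t : E ⊗[ℂ] ⋀[ℂ]^p L) :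
    differentialOp ρ f p (chainCoords E L p t) = chainCoords E L (p - 1) (differential ρ f p t) := by
  change chainCoords E L (p - 1) (differential ρ f p
    ((chainCoords E L p).symm (chainCoords E L p t))) = _
  rw [LinearEquiv.symm_apply_apply]

/-- Exactness of the complex in degree `p`. -/
def ExactAt (ρ : L →ₗ⁅ℂ⁆ (E →L[ℂ] E)ᵐᵒᵖ) (f : Module.Dual ℂ L) (p : ℕ) : Prop :=
  LinearMap.range (differential ρ f (p + 1)) = LinearMap.ker (differential ρ f p)

/-- The range of `d_p(f)` is closed. -/
def ClosedRange (ρ : L →ₗ⁅ℂ⁆ (E →L[ℂ] E)ᵐᵒᵖ) (f : Module.Dual ℂ L) (p : ℕ) : Prop :=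
  IsClosed[tensorTopology E (⋀[ℂ]^(p - 1) L)]
    (LinearMap.range (differential ρ f p) : Set (E ⊗[ℂ] ⋀[ℂ]^(p - 1) L))

variable (ρ : L →ₗ⁅ℂ⁆ (E →L[ℂ] E)ᵐᵒᵖ) (f : Module.Dual ℂ L)

theorem closedRange_iff (p : ℕ) : ClosedRange ρ f p ↔
    IsClosed ((differentialOp ρ f p).toLinearMap.range :
      Set (Chain E L (p - 1))) := by
  have : (chainCoords E L (p - 1) '' (LinearMap.range (differential ρ f p) : Set (E ⊗[ℂ] ⋀[ℂ]^(p - 1) L))) =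
      ((differentialOp ρ f p).toLinearMap.range :
        Set (Chain E L (p - 1))) := by
    ext x
    constructor
    · rintro ⟨_, ⟨t, rfl⟩, rfl⟩
      exact ⟨_, differentialOp_chainCoords ρ f p t⟩
    · rintro ⟨y, rfl⟩
      exact ⟨_, ⟨(chainCoords E L p).symm y, rfl⟩, rfl⟩
  rw [← this]
  exact isClosed_tensorTopology_iff _ _

theorem exactAt_iff (p : ℕ) : ExactAt ρ f p ↔
    ∀ x : Chain E L p, (∃ y, differentialOp ρ f (p + 1) y = x) ↔ differentialOp ρ f p x = 0 := by
  have h1 : ∀ t : E ⊗[ℂ] ⋀[ℂ]^p L, (∃ y, differentialOp ρ f (p + 1) y = chainCoords E L p t) ↔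
      t ∈ LinearMap.range (differential ρ f (p + 1)) := by
    intro t
    constructor
    · rintro ⟨y, hy⟩
      obtain ⟨s, rfl⟩ := (chainCoords E L (p + 1)).surjective y
      rw [differentialOp_chainCoords] at hy
      exact ⟨s, (chainCoords E L p).injective hy⟩
    · rintro ⟨s, rfl⟩
      exact ⟨_, differentialOp_chainCoords ρ f (p + 1) s⟩
  have h2 : ∀ t : E ⊗[ℂ] ⋀[ℂ]^p L, differentialOp ρ f p (chainCoords E L p t) = 0 ↔
      t ∈ LinearMap.ker (differential ρ f p) := by
    intro t
    rw [differentialOp_chainCoords, LinearEquiv.map_eq_zero_iff, LinearMap.mem_ker]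
  rw [ExactAt, SetLike.ext_iff, (chainCoords E L p).surjective.forall]
  exact forall_congr' fun t => by rw [h1, h2]

/-- The range is the kernel of a bounded operator. -/
theorem ExactAt.closedRange {p : ℕ} (h : ExactAt ρ f p) : ClosedRange ρ f (p + 1) := by
  rw [closedRange_iff]
  have : ((differentialOp ρ f (p + 1)).toLinearMap.range :
      Set (Chain E L (p + 1 - 1))) = {x | differentialOp ρ f p x = 0} := by
    ext x
    exact (exactAt_iff ρ f p).1 h x
  rw [this]
  exact isClosed_eq (differentialOp ρ f p).continuous continuous_const

/-- The convention d_p = 0 for p > n is automatic, because ⋀^p L = 0. -/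
theorem differential_of_finrank_lt {p : ℕ} (hp : Module.finrank ℂ L < p) :
    differential ρ f p = 0 := by
  have h0 : Module.finrank ℂ (⋀[ℂ]^p L) = 0 := by
    rw [exteriorPower.finrank_eq, Nat.choose_eq_zero_of_lt hp]
  have := Module.finrank_zero_iff.1 h0
  refine TensorProduct.ext' fun e w => ?_
  rw [Subsingleton.elim w 0, TensorProduct.tmul_zero, map_zero, map_zero]

theorem closedRange_of_eq_zero {p : ℕ} (h : differential ρ f p = 0) : ClosedRange ρ f p := by
  rw [closedRange_iff]
  have : (differentialOp ρ f p).toLinearMap = 0 := by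
    refine LinearMap.ext fun x => ?_
    obtain ⟨t, rfl⟩ := (chainCoords E L p).surjective x
    exact (differentialOp_chainCoords ρ f p t).trans (by simp [h])
  rw [this, LinearMap.range_zero]
  exact isClosed_singleton

theorem closedRange_zero : ClosedRange ρ f 0 := closedRange_of_eq_zero ρ f rfl

end Differential

/-! ### Duality of the complexes of `L` and `L'` -/

section Duality

variable {E L : Type*} [NormedAddCommGroup E] [NormedSpace ℂ E] [LieRing L] [LieAlgebra ℂ L]

theorem finrank_oppositeLie : Module.finrank ℂ (OppositeLie L) = Module.finrank ℂ L :=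
  (ofOpposite L).finrank_eq

/-- A linear form on `L`, regarded as a linear form on `L'`. -/
abbrev oppositeForm (f : Module.Dual ℂ L) : Module.Dual ℂ (OppositeLie L) :=
  f ∘ₗ (ofOpposite L : OppositeLie L →ₗ[ℂ] L)

theorem shifted_dualAction (ρ : L →ₗ⁅ℂ⁆ (E →L[ℂ] E)ᵐᵒᵖ) (f : Module.Dual ℂ L) (x : OppositeLie L)
    (φ : StrongDual ℂ E) (e : E) :
    shifted (dualAction ρ) (oppositeForm f) x φ e = φ (shifted ρ f (ofOpposite L x) e) := by
  have h : ∀ φ : StrongDual ℂ E, (dualAction ρ x).unop φ e = φ ((ρ (ofOpposite L x)).unop e) :=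
    fun _ => rfl
  simp [shifted, h]

variable [FiniteDimensional ℂ L]

instance : FiniteDimensional ℂ (OppositeLie L) := (ofOpposite L).symm.finiteDimensional

/-- A linear form on the exterior algebra of `L` that is injective on the top degree. -/
def volumeForm (L : Type*) [LieRing L] [LieAlgebra ℂ L] [FiniteDimensional ℂ L] :
    ExteriorAlgebra ℂ L →ₗ[ℂ] ℂ := (exists_volumeForm L).choose

theorem exists_dualEquiv (E : Type*) [NormedAddCommGroup E] [NormedSpace ℂ E] {p q : ℕ}
    (h : p + q = Module.finrank ℂ L) :
    ∃ Ψ : StrongDual ℂ E ⊗[ℂ] ⋀[ℂ]^q (OppositeLie L) ≃ₗ[ℂ] StrongDual ℂ (Chain E L p),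
      (∀ φ w e u, Ψ (φ ⊗ₜ w) (chainCoords E L p (e ⊗ₜ u)) = φ e * volumeForm L
        (u * ExteriorAlgebra.map (ofOpposite L : OppositeLie L →ₗ[ℂ] L) w)) ∧
      ∀ S, IsClosed[tensorTopology (StrongDual ℂ E) (⋀[ℂ]^q (OppositeLie L))] S ↔
        IsClosed (Ψ '' S) := by
  obtain ⟨β, hβ⟩ := exists_pairing (ofOpposite L) (exists_volumeForm L).choose_spec h
  obtain ⟨Ψ, h1, h2⟩ := exists_dual_tensor_equiv (E := E) (Module.finBasis ℂ (⋀[ℂ]^p L)) β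
  exact ⟨Ψ, fun φ w e u => (h1 φ w e u).trans (by rw [hβ]; rfl), h2⟩

/-- The identification of `E* ⊗ ⋀^q L'` with the dual space of `E ⊗ ⋀^p L`, `p + q = dim L`. -/
def dualEquiv (E : Type*) [NormedAddCommGroup E] [NormedSpace ℂ E] {p q : ℕ}
    (h : p + q = Module.finrank ℂ L) :
    StrongDual ℂ E ⊗[ℂ] ⋀[ℂ]^q (OppositeLie L) ≃ₗ[ℂ] StrongDual ℂ (Chain E L p) :=
  (exists_dualEquiv E h).choose

theorem dualEquiv_tmul {p q : ℕ} (h : p + q = Module.finrank ℂ L) (φ : StrongDual ℂ E)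
    (w : ⋀[ℂ]^q (OppositeLie L)) (e : E) (u : ⋀[ℂ]^p L) :
    dualEquiv E h (φ ⊗ₜ w) (chainCoords E L p (e ⊗ₜ u)) = φ e * volumeForm L
      (u * ExteriorAlgebra.map (ofOpposite L : OppositeLie L →ₗ[ℂ] L) w) :=
  (exists_dualEquiv E h).choose_spec.1 φ w e u

theorem isClosed_iff_dualEquiv {p q : ℕ} (h : p + q = Module.finrank ℂ L)
    (S : Set (StrongDual ℂ E ⊗[ℂ] ⋀[ℂ]^q (OppositeLie L))) :
    IsClosed[tensorTopology (StrongDual ℂ E) (⋀[ℂ]^q (OppositeLie L))] S ↔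
      IsClosed (dualEquiv E h '' S) :=
  (exists_dualEquiv E h).choose_spec.2 S

/-- The differentials of the complex of `L'` on `E*` are, up to sign, the adjoints of the
differentials of the complex of `L` on `E`. -/
theorem dualEquiv_boundary (ρ : L →ₗ⁅ℂ⁆ (E →L[ℂ] E)ᵐᵒᵖ) (f : Module.Dual ℂ L)
    (htr : ∀ x : L, LinearMap.trace ℂ L (LieAlgebra.ad ℂ L x) = 0) {p q : ℕ}
    (h : p + (q + 1) = Module.finrank ℂ L) (h' : p + 1 + q = Module.finrank ℂ L)
    (t : StrongDual ℂ E ⊗[ℂ] ⋀[ℂ]^(q + 1) (OppositeLie L)) :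
    dualEquiv E h' (differential (dualAction ρ) (oppositeForm f) (q + 1) t) =
      (-1 : ℂ) ^ p • dualOp (differentialOp ρ f (p + 1)) (dualEquiv E h t) := by
  ext x
  obtain ⟨s, rfl⟩ := (chainCoords E L (p + 1)).surjective x
  rw [smul_apply, dualOp_apply, differentialOp_chainCoords]
  induction t with
  | zero => simp
  | add t t' ht ht' =>
    simp only [map_add, add_apply, smul_add, ht, ht']
  | tmul φ w =>
  induction s with
  | zero => simp
  | add s s' hs hs' => simp only [map_add, smul_add, hs, hs']
  | tmul e u =>
  let b := Module.finBasis ℂ L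
  let τ : OppositeLie L →ₗ[ℂ] L := ofOpposite L
  have hw : ExteriorAlgebra.map τ (w : ExteriorAlgebra ℂ (OppositeLie L)) ∈ ⋀[ℂ]^(q + 1) L :=
    map_mem_exteriorPower τ w.2
  have hmul : (u : ExteriorAlgebra ℂ L) * ExteriorAlgebra.map τ w = 0 :=
    eq_zero_of_mem_of_finrank_lt (m := p + 1 + (q + 1)) (by omega)
      (mul_mem_exteriorPower rfl u.2 hw)
  have hg : gradeInv (u : ExteriorAlgebra ℂ L) = -((-1 : ℂ) ^ p • (u : ExteriorAlgebra ℂ L)) := by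
    rw [gradeInv_of_mem u.2, pow_succ, mul_neg, mul_one, neg_smul]
  have hb : ∀ i, (b.map (ofOpposite L).symm).coord i = b.coord i ∘ₗ τ := by
    intro i
    ext x
    simp [τ]
  -- Both terms must cross the pairing with the same sign (-1)^p. Here it comes from the grading
  -- sign (-1)^(p+1) and the minus of integration by parts.
  have hcon : ∀ i, contract (b.coord i) (u : ExteriorAlgebra ℂ L) * ExteriorAlgebra.map τ w =
      (-1 : ℂ) ^ p • (u * ExteriorAlgebra.map τ (contract (b.coord i ∘ₗ τ) w)) := by
    intro i
    rw [contract_mul_of_mul_eq_zero _ hmul, hg, neg_mul, neg_neg, smul_mul_assoc, contract_map]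
  -- Here there is no minus from integration by parts; the one written before `bracketOp` is
  -- supplied by the opposite bracket.
  have hbr : bracketOp b (u : ExteriorAlgebra ℂ L) * ExteriorAlgebra.map τ w =
      (-1 : ℂ) ^ p • (u * -bracketOp b (ExteriorAlgebra.map τ w)) := by
    rw [bracketOp_mul htr b (p := p) (q := q) (by omega) u.2 hw, hg, neg_mul, mul_neg,
      smul_mul_assoc, smul_neg]
  have hsq : (-1 : ℂ) ^ p * (-1 : ℂ) ^ p = 1 := by
    rw [← mul_pow]
    simp
  change dualEquiv E h' (boundary (dualAction ρ) (oppositeForm f) q (φ ⊗ₜ w))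
    (chainCoords E L (p + 1) (e ⊗ₜ u)) =
    (-1 : ℂ) ^ p • dualEquiv E h (φ ⊗ₜ w) (chainCoords E L p (boundary ρ f p (e ⊗ₜ u)))
  rw [boundary_tmul _ _ _ (b.map (ofOpposite L).symm), boundary_tmul _ _ _ b]
  simp only [map_add, map_sum, add_apply, sum_apply, dualEquiv_tmul,
    shifted_dualAction, hb, coe_contractPow, coe_bracketPart b, map_bracketPart_opposite b]
  change _ = (-1 : ℂ) ^ p • (∑ i, φ (shifted ρ f (b i) e) *
      volumeForm L (contract (b.coord i) u * ExteriorAlgebra.map τ w) +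
    φ e * volumeForm L (bracketOp b u * ExteriorAlgebra.map τ w))
  simp only [hcon, hbr, map_smul, smul_eq_mul, mul_left_comm _ ((-1 : ℂ) ^ p), ← Finset.mul_sum]
  rw [← mul_add, ← mul_assoc, hsq, one_mul]
  simp [τ]

variable (ρ : L →ₗ⁅ℂ⁆ (E →L[ℂ] E)ᵐᵒᵖ) (f : Module.Dual ℂ L)

theorem differentialOp_eq_zero {p : ℕ} (h : differential ρ f p = 0) :
    differentialOp ρ f p = 0 := by
  refine ContinuousLinearMap.ext fun x => ?_
  obtain ⟨t, rfl⟩ := (chainCoords E L p).surjective x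
  exact (differentialOp_chainCoords ρ f p t).trans (by simp [h])

theorem dualOp_zero {X Y : Type*} [NormedAddCommGroup X] [NormedSpace ℂ X]
    [NormedAddCommGroup Y] [NormedSpace ℂ Y] (ψ : StrongDual ℂ Y) :
    dualOp (0 : X →L[ℂ] Y) ψ = 0 := by
  ext
  simp

/-- At q = 0 the map d_0 = 0 of L' corresponds to d_(n+1) = 0 of L. -/
theorem mem_ker_differential_dual_iff
    (htr : ∀ x : L, LinearMap.trace ℂ L (LieAlgebra.ad ℂ L x) = 0)
    {p q : ℕ} (h : p + q = Module.finrank ℂ L)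
    (t : StrongDual ℂ E ⊗[ℂ] ⋀[ℂ]^q (OppositeLie L)) :
    differential (dualAction ρ) (oppositeForm f) q t = 0 ↔
      dualOp (differentialOp ρ f (p + 1)) (dualEquiv E h t) = 0 := by
  cases q with
  | zero =>
    rw [differentialOp_eq_zero ρ f (differential_of_finrank_lt ρ f (by omega)), dualOp_zero]
    simp [differential]
  | succ q =>
    rw [← (dualEquiv E (show p + 1 + q = _ by omega)).map_eq_zero_iff,
      dualEquiv_boundary ρ f htr h]
    exact smul_eq_zero_iff_right (R := ℂ) (M := StrongDual ℂ (Chain E L (p + 1)))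
      (pow_ne_zero p (neg_ne_zero.2 one_ne_zero))

/-- At p = 0 the map d_(n+1) = 0 of L' corresponds to d_0 = 0 of L. Otherwise the sign is absorbed
into the preimage. -/
theorem mem_range_differential_dual_iff
    (htr : ∀ x : L, LinearMap.trace ℂ L (LieAlgebra.ad ℂ L x) = 0)
    {p q : ℕ} (h : p + q = Module.finrank ℂ L)
    (t : StrongDual ℂ E ⊗[ℂ] ⋀[ℂ]^q (OppositeLie L)) :
    (∃ s, differential (dualAction ρ) (oppositeForm f) (q + 1) s = t) ↔
      ∃ ψ, dualOp (differentialOp ρ f p) ψ = dualEquiv E h t := by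
  cases p with
  | zero =>
    rw [differential_of_finrank_lt (dualAction ρ) _ (by rw [finrank_oppositeLie]; omega),
      differentialOp_eq_zero ρ f (p := 0) rfl]
    simp only [LinearMap.zero_apply, exists_const, dualOp_zero]
    rw [eq_comm, eq_comm (a := (0 : StrongDual ℂ (Chain E L 0))), LinearEquiv.map_eq_zero_iff]
  | succ p =>
    have h' : p + (q + 1) = Module.finrank ℂ L := by omega
    have hpow : ((-1 : ℂ) ^ p) ≠ 0 := pow_ne_zero _ (by simp)
    constructor
    · rintro ⟨s, rfl⟩
      refine ⟨(-1 : ℂ) ^ p • dualEquiv E h' s, ?_⟩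
      exact (map_smul _ _ _).trans (dualEquiv_boundary ρ f htr h' h s).symm
    · rintro ⟨ψ, hψ⟩
      obtain ⟨s, rfl⟩ := (dualEquiv E h').surjective ψ
      refine ⟨((-1 : ℂ) ^ p)⁻¹ • s, (dualEquiv E h).injective ?_⟩
      rw [map_smul, ← hψ]
      refine ((dualEquiv E h).map_smul _ _).trans ?_
      rw [dualEquiv_boundary ρ f htr h' h, smul_smul, inv_mul_cancel₀ hpow, one_smul]

theorem closedRange_dual_iff [CompleteSpace E]
    (htr : ∀ x : L, LinearMap.trace ℂ L (LieAlgebra.ad ℂ L x) = 0)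
    {p q : ℕ} (h : p + q = Module.finrank ℂ L) :
    ClosedRange (dualAction ρ) (oppositeForm f) q ↔ ClosedRange ρ f (p + 1) := by
  cases q with
  | zero =>
    have h1 := closedRange_zero (dualAction ρ) (oppositeForm f)
    have h2 := closedRange_of_eq_zero ρ f (p := p + 1) (differential_of_finrank_lt ρ f (by omega))
    exact iff_of_true h1 h2
  | succ q =>
    have h' : p + 1 + q = Module.finrank ℂ L := by omega
    have himage : dualEquiv E h' '' (LinearMap.range (differential (dualAction ρ) (oppositeForm f)
        (q + 1)) : Set (StrongDual ℂ E ⊗[ℂ] ⋀[ℂ]^(q + 1 - 1) (OppositeLie L))) =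
        Set.range (dualOp (differentialOp ρ f (p + 1))) := by
      ext ψ
      obtain ⟨t, rfl⟩ := (dualEquiv E h').surjective ψ
      rw [(dualEquiv E h').injective.mem_set_image]
      exact mem_range_differential_dual_iff ρ f htr h' t
    rw [closedRange_iff ρ f, ← isClosed_range_dualOp_iff, ← himage]
    exact isClosed_iff_dualEquiv h' _

theorem exactAt_dual_iff
    (htr : ∀ x : L, LinearMap.trace ℂ L (LieAlgebra.ad ℂ L x) = 0)
    {p q : ℕ} (h : p + q = Module.finrank ℂ L) :
    ExactAt (dualAction ρ) (oppositeForm f) q ↔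
      ∀ φ : StrongDual ℂ (Chain E L p), (∃ ψ, dualOp (differentialOp ρ f p) ψ = φ) ↔
        dualOp (differentialOp ρ f (p + 1)) φ = 0 := by
  rw [ExactAt, SetLike.ext_iff, (dualEquiv E h).surjective.forall]
  refine forall_congr' fun t => ?_
  rw [← mem_ker_differential_dual_iff ρ f htr h, ← mem_range_differential_dual_iff ρ f htr h]
  rfl

/-- A functional killed by the adjoint of d_(p+1) vanishes on R(d_(p+1)) = ker d_p, so it lies in
the range of the adjoint of the closed-range operator d_p. -/
theorem ExactAt.dual [CompleteSpace E]
    (htr : ∀ x : L, LinearMap.trace ℂ L (LieAlgebra.ad ℂ L x) = 0)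
    {p q : ℕ} (h : p + q = Module.finrank ℂ L)
    (hex : ExactAt ρ f p) (hcl : ClosedRange ρ f p) :
    ExactAt (dualAction ρ) (oppositeForm f) q := by
  rw [exactAt_iff] at hex
  rw [closedRange_iff] at hcl
  rw [exactAt_dual_iff ρ f htr h]
  intro φ
  constructor
  · rintro ⟨ψ, rfl⟩
    ext y
    exact (congrArg ψ ((hex _).1 ⟨y, rfl⟩)).trans (map_zero ψ)
  · intro hφ
    refine mem_range_dualOp _ hcl φ fun x hx => ?_
    obtain ⟨y, rfl⟩ := (hex x).2 hx
    exact congrArg (fun g => g y) hφ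

/-- That d_p ∘ d_(p+1) = 0 is tested against functionals. If d_p x = 0, every functional vanishing
on R(d_(p+1)) has the form ψ ∘ d_p and kills x; Hahn-Banach puts x in the closed range. -/
theorem ExactAt.of_dual
    (htr : ∀ x : L, LinearMap.trace ℂ L (LieAlgebra.ad ℂ L x) = 0)
    {p q : ℕ} (h : p + q = Module.finrank ℂ L)
    (hex : ExactAt (dualAction ρ) (oppositeForm f) q) (hcl : ClosedRange ρ f (p + 1)) :
    ExactAt ρ f p := by
  rw [exactAt_dual_iff ρ f htr h] at hex
  rw [closedRange_iff] at hcl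
  rw [exactAt_iff]
  intro x
  constructor
  · rintro ⟨y, rfl⟩
    refine SeparatingDual.eq_zero_of_forall_dual_eq_zero (R := ℂ) fun ψ => ?_
    exact congrArg (fun g => g y) ((hex _).1 ⟨ψ, rfl⟩)
  · intro hx
    refine mem_range_of_forall_dual _ hcl x fun φ hφ => ?_
    obtain ⟨ψ, rfl⟩ := (hex φ).2 hφ
    rw [dualOp_apply, hx, map_zero]

end Duality

/-! ### The duality of the spectra -/

section SpectralDuality

variable {E L : Type*} [NormedAddCommGroup E] [NormedSpace ℂ E] [LieRing L] [LieAlgebra ℂ L]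

theorem notMem_sigmaDelta_iff (ρ : L →ₗ⁅ℂ⁆ (E →L[ℂ] E)ᵐᵒᵖ) {f : Module.Dual ℂ L}
    (hf : f ∈ characters L) (k : ℕ) : f ∉ sigmaDelta ρ k ↔ ∀ p ≤ k, ExactAt ρ f p := by
  simp [sigmaDelta, Sig, ExactAt, hf]

theorem notMem_sigmaPi_iff (ρ : L →ₗ⁅ℂ⁆ (E →L[ℂ] E)ᵐᵒᵖ) {f : Module.Dual ℂ L}
    (hf : f ∈ characters L) (k : ℕ) : f ∉ sigmaPi ρ k ↔
      (∀ p, k ≤ p → p ≤ Module.finrank ℂ L → ExactAt ρ f p) ∧ ClosedRange ρ f k := by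
  simp [sigmaPi, Sig, ExactAt, ClosedRange, hf]

theorem characters_of_mem_sigmaDelta {ρ : L →ₗ⁅ℂ⁆ (E →L[ℂ] E)ᵐᵒᵖ} {f : Module.Dual ℂ L} {k : ℕ}
    (h : f ∈ sigmaDelta ρ k) : f ∈ characters L := by
  obtain ⟨p, -, hp⟩ := Set.mem_iUnion₂.1 h
  exact hp.1

theorem characters_of_mem_sigmaPi {ρ : L →ₗ⁅ℂ⁆ (E →L[ℂ] E)ᵐᵒᵖ} {f : Module.Dual ℂ L} {k : ℕ}
    (h : f ∈ sigmaPi ρ k) : f ∈ characters L := by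
  rcases h with h | h
  · obtain ⟨p, -, hp⟩ := Set.mem_iUnion₂.1 h
    exact hp.1
  · exact h.1

theorem oppositeForm_mem_characters_iff {f : Module.Dual ℂ L} :
    f ∘ₗ (ofOpposite L : OppositeLie L →ₗ[ℂ] L) ∈ characters (OppositeLie L) ↔
      f ∈ characters L := by
  constructor
  · intro h x y
    exact h ((ofOpposite L).symm y) ((ofOpposite L).symm x)
  · intro h x y
    exact h (ofOpposite L y) (ofOpposite L x)

variable [FiniteDimensional ℂ L] [CompleteSpace E] (ρ : L →ₗ⁅ℂ⁆ (E →L[ℂ] E)ᵐᵒᵖ)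

theorem sigmaDelta_eq_sigmaPi_dual
    (htr : ∀ x : L, LinearMap.trace ℂ L (LieAlgebra.ad ℂ L x) = 0)
    {k : ℕ} (hk : k ≤ Module.finrank ℂ L) :
    sigmaDelta ρ k = toDualOf (sigmaPi (dualAction ρ) (Module.finrank ℂ L - k)) := by
  ext f
  by_cases hf : f ∈ characters L
  swap
  · exact iff_of_false (fun h => hf (characters_of_mem_sigmaDelta h))
      fun h => hf (oppositeForm_mem_characters_iff.1 (characters_of_mem_sigmaPi h))
  rw [← not_iff_not, notMem_sigmaDelta_iff ρ hf]
  refine Iff.trans ?_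
    (notMem_sigmaPi_iff (dualAction ρ) (oppositeForm_mem_characters_iff.2 hf) _).symm
  rw [finrank_oppositeLie]
  constructor
  · intro h
    refine ⟨fun q hq hq' => ?_, ?_⟩
    · refine (h (Module.finrank ℂ L - q) (by omega)).dual ρ f htr (by omega) ?_
      cases hp : Module.finrank ℂ L - q with
      | zero => exact closedRange_zero ρ f
      | succ p => exact (h p (by omega)).closedRange
    · exact (closedRange_dual_iff ρ f htr (p := k) (by omega)).2 (h k le_rfl).closedRange
  · rintro ⟨h1, h2⟩ p hp
    refine (h1 (Module.finrank ℂ L - p) (by omega) (by omega)).of_dual ρ f htr (by omega) ?_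
    rw [← closedRange_dual_iff ρ f htr (q := Module.finrank ℂ L - p) (by omega)]
    -- For p < k closedness follows from exactness one degree lower in the dual complex. For p = k
    -- that degree is out of reach, and the closed range condition of σ_π replaces it.
    rcases hp.eq_or_lt with rfl | hlt
    · exact h2
    · obtain ⟨q, hq⟩ : ∃ q, Module.finrank ℂ L - p = q + 1 :=
        ⟨Module.finrank ℂ L - p - 1, by omega⟩
      rw [hq]
      exact (h1 q (by omega) (by omega)).closedRange

theorem sigmaPi_eq_sigmaDelta_dual
    (htr : ∀ x : L, LinearMap.trace ℂ L (LieAlgebra.ad ℂ L x) = 0)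
    {k : ℕ} (hk : k ≤ Module.finrank ℂ L) :
    sigmaPi ρ k = toDualOf (sigmaDelta (dualAction ρ) (Module.finrank ℂ L - k)) := by
  ext f
  by_cases hf : f ∈ characters L
  swap
  · exact iff_of_false (fun h => hf (characters_of_mem_sigmaPi h))
      fun h => hf (oppositeForm_mem_characters_iff.1 (characters_of_mem_sigmaDelta h))
  rw [← not_iff_not, notMem_sigmaPi_iff ρ hf]
  refine Iff.trans ?_
    (notMem_sigmaDelta_iff (dualAction ρ) (oppositeForm_mem_characters_iff.2 hf) _).symm
  constructor
  · rintro ⟨h1, h2⟩ q hq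
    refine (h1 (Module.finrank ℂ L - q) (by omega) (by omega)).dual ρ f htr (by omega) ?_
    -- Only d_k needs the closed range hypothesis; above k, exactness one degree lower suffices.
    rcases (show k ≤ Module.finrank ℂ L - q by omega).eq_or_lt with he | hlt
    · rwa [← he]
    · obtain ⟨p, hp⟩ : ∃ p, Module.finrank ℂ L - q = p + 1 :=
        ⟨Module.finrank ℂ L - q - 1, by omega⟩
      rw [hp]
      exact (h1 p (by omega) (by omega)).closedRange
  · intro h
    -- The extra degree n - k + 1 is the one whose differential is dual to d_k.
    have hcl : ∀ q ≤ Module.finrank ℂ L - k + 1,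
        ClosedRange (dualAction ρ) (oppositeForm f) q := by
      intro q hq
      cases q with
      | zero => exact closedRange_zero _ _
      | succ q => exact (h q (by omega)).closedRange
    refine ⟨fun p hp hp' => ?_, ?_⟩
    · refine (h (Module.finrank ℂ L - p) (by omega)).of_dual ρ f htr (by omega) ?_
      rw [← closedRange_dual_iff ρ f htr (q := Module.finrank ℂ L - p) (by omega)]
      exact hcl _ (by omega)
    · cases k with
      | zero => exact closedRange_zero ρ f
      | succ k =>
        rw [← closedRange_dual_iff ρ f htr (q := Module.finrank ℂ L - k) (by omega)]
        exact hcl _ (by omega)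

end SpectralDuality

end SolvableLieSpectra

end

theorem theorem4p12 {E : Type*} [NormedAddCommGroup E] [NormedSpace ℂ E] [CompleteSpace E]
    (L : LieSubalgebra ℂ (E →L[ℂ] E)ᵐᵒᵖ) [FiniteDimensional ℂ L] [LieRing.IsNilpotent L]
    (k : ℕ) (hk : k ≤ Module.finrank ℂ L) :
    SolvableLieSpectra.sigmaDelta L.incl k =
        SolvableLieSpectra.toDualOf (SolvableLieSpectra.sigmaPi
          (SolvableLieSpectra.dualAction L.incl) (Module.finrank ℂ L - k)) ∧
      SolvableLieSpectra.sigmaPi L.incl k =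
        SolvableLieSpectra.toDualOf (SolvableLieSpectra.sigmaDelta
          (SolvableLieSpectra.dualAction L.incl) (Module.finrank ℂ L - k)) :=
  ⟨SolvableLieSpectra.sigmaDelta_eq_sigmaPi_dual L.incl SolvableLieSpectra.trace_ad_eq_zero hk,
    SolvableLieSpectra.sigmaPi_eq_sigmaDelta_dual L.incl SolvableLieSpectra.trace_ad_eq_zero hk⟩
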